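/- **Setting.** Let $R$ be a ring and let $H_*$ denote singular homology with coefficients in $R$, a graded $R$-module. Let $\mathrm{Mod}$ be the category of graded $R$-modules with homomorphisms of degree zero. Let $\operatorname{Endo}(\mathrm{Mod})$ be the category of pairs $(A,a)$ with $a:A\to A$ in $\mathrm{Mod}$, whose morphisms $(A,a)\to(B,b)$ are the morphisms $\varphi:A\to B$ of $\mathrm{Mod}$ with $\varphi a=b\varphi$; let $\operatorname{Auto}(\mathrm{Mod})$ be its full subcategory of pairs with $a$ an automorphism. Fix a normal functor $L:\operatorname{Endo}(\mathrm{Mod})\to\operatorname{Auto}(\mathrm{Mod})$, that is, a functor for which $L(a:(A,a)\to(A,a))$ is an isomorphism for every object $(A,a)$. Let $X$ be a finite $T_0$ topological space. Call a multivalued map $F:X\multimap Y$ *admissible* if it is lower semicontinuous ($\{x: F(x)\subset H\}$ is closed for every closed $H$) and every value $F(x)$ is closed and acyclic (has the homology of a point). Two admissible maps $F,G:X\multimap X$ are *homotopic* if there is an admissible $H:X\times[0,1]\multimap X$ with $H(\cdot,0)=F$ and $H(\cdot,1)=G$. Write $F\le G$ if $F(x)\subset G(x)$ for all $x$, and $F(A)=\bigcup_{x\in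 A}F(x)$. **Isolated invariant sets and index pairs.** A full solution of $F$ in $A\subset X$ is a map $\sigma:\mathbb Z\to A$ with $\sigma(i+1)\in F(\sigma(i))$ for all $i$; a path in $A$ is such a map defined on a nonempty bounded interval of integers. $\operatorname{Inv}(A)$ is the set of points of $A$ through which a full solution in $A$ passes, and $A$ is invariant if $A=\operatorname{Inv}(A)$. A closed set $N$ is an *isolating set* for an invariant set $S$ if every path in $N$ with endpoints in $S$ lies in $S$, and $S\cap\operatorname{cl}(F(S)\setminus N)=\emptyset$; $S$ is an *isolated invariant set* if it has an isolating set. An *index pair* for $S$ in the isolating set $N$ is a pair $P=(P_1,P_2)$ of closed sets $P_2\subset P_1\subset N$ with $F(P_i)\cap N\subset P_i$ for $i=1,2$, $P_1\cap\operatorname{cl}(F(P_1)\setminus N)\subset P_2$, and $S=\operatorname{Inv}(P_1\setminus P_2)$. **Conley index.** For an index pair $P$ in $N$ put $\bar P_i=P_i\cup\operatorname{cl}(F(P_1)\setminus N)$. Then $F$ restricts to a multivalued map of pairs $F_P:P\multimap\bar P$, which induces $(F_P)_*=(p_2)_*(p_1)_*^{-1}:H_*(P)\to H_*(\bar P)$,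 where $p_1,p_2$ are the projections of the graph of $F_P$ (a pair of spaces) to $P$ and $\bar P$. With $\iota_P:P\to\bar P$ the inclusion, the index map is $I_P=(\iota_P)_*^{-1}(F_P)_*$. The Conley index is $C(S,F)=L(H_*(P),I_P)\in\operatorname{Auto}(\mathrm{Mod})$, for any isolating set $N$ for $S$ and any index pair $P$ for $S$ in $N$. **Continuation.** Let $S_F,S_G$ be isolated invariant sets of admissible maps $F,G:X\multimap X$ with $F\le G$ or $G\le F$. Then $(S_F,F)$ and $(S_G,G)$ are *related by an elementary continuation* if there are isolating sets $N_F$ for $S_F$ (with respect to $F$) and $N_G$ for $S_G$ (with respect to $G$), and a pair $P$ that is both an index pair for $S_F$ in $N_F$ with respect to $F$ and an index pair for $S_G$ in $N_G$ with respect to $G$. In general, isolated invariant sets $S_F,S_G$ of homotopic admissible maps $F,G$ are *related by continuation* if there are a fence $F=F_0\le F_1\ge F_2\le\cdots F_k=G$ of admissible maps $X\multimap X$ and isolated invariant sets $S_i$ for $F_i$, $0\le i\le k$, with $S_0=S_F$, $S_k=S_G$, such that $(S_i,F_i)$ and $(S_{i+1},F_{i+1})$ are related by an elementary continuation for $0\le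 i<k$. **Proposition 7.4 (Continuation).** Let $F,G:X\multimap X$ be homotopic lower semicontinuous multivalued maps with closed and acyclic values, and let $S_F$ and $S_G$ be isolated invariant sets for $F$ and $G$, respectively, which are related by continuation. Then the Conley indices $C(S_F,F)$ and $C(S_G,G)$ are defined (index pairs for $S_F$ and $S_G$ exist, and for each of them $F_P$, respectively $G_P$, is a map of pairs and $(p_1)_*$ and $(\iota_P)_*$ are isomorphisms), and $C(S_F,F)$ is isomorphic to $C(S_G,G)$ in $\operatorname{Auto}(\mathrm{Mod})$, whatever isolating sets and index pairs are used to compute them. -/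

import Mathlib

open CategoryTheory

universe u v

noncomputable section

namespace FiniteConley

/-! ### Categories of endomorphisms and automorphisms, normal functors -/

section NormalFunctors

universe w₁ w₂ w₃ w₄

/-- Objects of the category of endomorphisms of a category `E`: pairs `(A, a)` with `a : A ⟶ A`. -/
structure Endo (E : Type w₁) [Category.{w₂} E] where
  obj : E
  endo : obj ⟶ obj

/-- A morphism `(A, a) ⟶ (B, b)` is a morphism `φ : A ⟶ B` of `E` with `φ a = b φ`. -/
@[ext]
structure Endo.Hom {E : Type w₁} [Category.{w₂} E] (A B : Endo E) where
  hom : A.obj ⟶ B.obj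
  comm : A.endo ≫ hom = hom ≫ B.endo

instance Endo.category (E : Type w₁) [Category.{w₂} E] : Category (Endo E) where
  Hom A B := Endo.Hom A B
  id A := ⟨𝟙 A.obj, by simp⟩
  comp f g := ⟨f.hom ≫ g.hom, by rw [← Category.assoc, f.comm, Category.assoc, g.comm,
    Category.assoc]⟩
  id_comp f := Endo.Hom.ext (Category.id_comp f.hom)
  comp_id f := Endo.Hom.ext (Category.comp_id f.hom)
  assoc f g h := Endo.Hom.ext (Category.assoc f.hom g.hom h.hom)

/-- The induced morphism `a : (A, a) ⟶ (A, a)`. -/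
def Endo.induced {E : Type w₁} [Category.{w₂} E] (A : Endo E) : A ⟶ A :=
  Endo.Hom.mk A.endo rfl

/-- The full subcategory of `Endo E` of the pairs `(A, a)` with `a` an automorphism of `A`. -/
abbrev Auto (E : Type w₁) [Category.{w₂} E] :=
  ObjectProperty.FullSubcategory (fun A : Endo E => IsIso A.endo)

/-- A functor on `Endo E` is normal if it sends every induced morphism to an isomorphism. -/
def IsNormal {E : Type w₁} [Category.{w₂} E] {C : Type w₃} [Category.{w₄} C]
    (L : Endo E ⥤ C) : Prop :=
  ∀ A : Endo E, IsIso (L.map A.induced)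

/-- The inverse of an isomorphism (with value `0` on the morphisms that are not invertible). -/
def inverse {E : Type w₁} [Category.{w₂} E] [Limits.HasZeroMorphisms E] {A B : E} (f : A ⟶ B) :
    B ⟶ A :=
  open scoped Classical in if _h : IsIso f then inv f else 0

end NormalFunctors

/-! ### Singular homology of spaces and of pairs, with coefficients in a ring -/

section Homology

variable (R : Type u) [Ring R]

/-- The category of graded `R`-modules and homomorphisms of degree zero. -/
abbrev GrMod := GradedObject ℕ (ModuleCat.{max u v} R)

/-- The relative singular chain complex `C(X, A; R) = C(X; R) / C(A; R)` of a pair `(X, A)`. -/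
def relativeChains : TopPair.{v} ⥤ ChainComplex (ModuleCat.{max u v} R) ℕ :=
  MorphismProperty.Arrow.forget _ _ _ ⋙
    ((AlgebraicTopology.singularChainComplexFunctor.{v} (ModuleCat.{max u v} R)).obj
      (ModuleCat.of R (ULift.{v} R))).mapArrow ⋙ Limits.coker _

/-- Relative singular homology `H_*(X, A; R)` of pairs of spaces, as a graded `R`-module. -/
def relativeHomology : TopPair.{v} ⥤ GrMod.{u, v} R :=
  relativeChains R ⋙ HomologicalComplex.gradedHomologyFunctor _ _

/-- A subspace `A` is acyclic if it has the singular homology of a point, that is, if the map from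
`A` to a point induces an isomorphism in all degrees. -/
def IsAcyclic {Y : Type v} [TopologicalSpace Y] (A : Set Y) : Prop :=
  ∀ n : ℕ, IsIso
    (((AlgebraicTopology.singularHomologyFunctor.{v} (ModuleCat.{max u v} R) n).obj
      (ModuleCat.of R (ULift.{v} R))).map
        (TopCat.ofHom (ContinuousMap.const A PUnit.unit) : TopCat.of A ⟶ TopCat.of PUnit.{v + 1}))

end Homology

/-- The pair of spaces `(A.1, A.2)` given by two subsets `A.2 ⊆ A.1` of a space, both with the
subspace topology. -/
def toPair {Y : Type v} [TopologicalSpace Y] (A : Set Y × Set Y) : TopPair.{v} :=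
  TopPair.ofSubset (X := TopCat.of A.1) (Subtype.val ⁻¹' A.2)

/-- The restriction of a continuous map to pairs of subspaces. -/
def pairMap {Y Z : Type v} [TopologicalSpace Y] [TopologicalSpace Z] (f : C(Y, Z))
    (A : Set Y × Set Y) (B : Set Z × Set Z) (h₁ : Set.MapsTo f A.1 B.1)
    (h₂ : Set.MapsTo f A.2 B.2) : toPair A ⟶ toPair B :=
  TopPair.ofHom (X := toPair A) (Y := toPair B)
    (TopCat.ofHom (X := A.1) (Y := B.1)
      ⟨fun a => ⟨f a.1, h₁ a.2⟩, by fun_prop⟩)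
    (TopCat.ofHom (X := (Subtype.val ⁻¹' A.2 : Set A.1)) (Y := (Subtype.val ⁻¹' B.2 : Set B.1))
      ⟨fun a => ⟨⟨f a.1.1, h₁ a.1.2⟩, h₂ a.2⟩, by fun_prop⟩)
    rfl

/-! ### Multivalued maps -/

section Multivalued

variable {X Y : Type v}

/-- The image `F(A)` of a set under a multivalued map. -/
def image (F : X → Set Y) (A : Set X) : Set Y := ⋃ x ∈ A, F x

variable [TopologicalSpace X] [TopologicalSpace Y]

/-- Lower semicontinuous multivalued maps with closed and acyclic values. Lower semicontinuity
means that `{x | F x ⊆ H}` is closed for every closed `H`. -/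
structure IsAdmissible (R : Type u) [Ring R] (F : X → Set Y) : Prop where
  lsc : ∀ H : Set Y, IsClosed H → IsClosed {x | F x ⊆ H}
  closed : ∀ x, IsClosed (F x)
  acyclic : ∀ x, IsAcyclic R (F x)

/-- Two multivalued maps are homotopic if they are the ends of a lower semicontinuous
`H : X × [0,1] ⊸ Y` with closed and acyclic values. -/
def IsHomotopic (R : Type u) [Ring R] (F G : X → Set Y) : Prop :=
  ∃ H : X × unitInterval → Set Y, IsAdmissible R H ∧
    (∀ x, H (x, 0) = F x) ∧ ∀ x, H (x, 1) = G x

/-- The graph of the multivalued map of pairs `P ⊸ Q` obtained by restricting `F`: the pair formed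
by the graphs of `P.1 ⊸ Q.1` and `P.2 ⊸ Q.2`. -/
def graphPair (F : X → Set Y) (P : Set X × Set X) (Q : Set Y × Set Y) :
    Set (X × Y) × Set (X × Y) :=
  ({z | z.1 ∈ P.1 ∧ z.2 ∈ Q.1 ∧ z.2 ∈ F z.1}, {z | z.1 ∈ P.2 ∧ z.2 ∈ Q.2 ∧ z.2 ∈ F z.1})

/-- The projection of the graph to the domain. -/
def graphFst (F : X → Set Y) (P : Set X × Set X) (Q : Set Y × Set Y) :
    toPair (graphPair F P Q) ⟶ toPair P :=
  pairMap ContinuousMap.fst _ _ (fun _ hz => hz.1) (fun _ hz => hz.1)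

/-- The projection of the graph to the codomain. -/
def graphSnd (F : X → Set Y) (P : Set X × Set X) (Q : Set Y × Set Y) :
    toPair (graphPair F P Q) ⟶ toPair Q :=
  pairMap ContinuousMap.snd _ _ (fun _ hz => hz.2.1) (fun _ hz => hz.2.1)

/-- The homomorphism `F_* = (p₂)_* (p₁)_*⁻¹ : H_*(P) ⟶ H_*(Q)` induced in homology by the
restriction `P ⊸ Q` of a multivalued map, with `p₁` and `p₂` the projections of its graph. -/
def inducedMap (R : Type u) [Ring R] (F : X → Set Y) (P : Set X × Set X) (Q : Set Y × Set Y) :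
    (relativeHomology.{u, v} R).obj (toPair P) ⟶ (relativeHomology.{u, v} R).obj (toPair Q) :=
  inverse ((relativeHomology.{u, v} R).map (graphFst F P Q)) ≫
    (relativeHomology.{u, v} R).map (graphSnd F P Q)

end Multivalued

/-! ### Solutions, invariant sets, isolating sets -/

section Dynamics

variable {X : Type v}

/-- `σ` restricts to a path of `F` in `A` with domain `{m, …, n}`. -/
structure IsPath (F : X → Set X) (A : Set X) (m n : ℤ) (σ : ℤ → X) : Prop where
  le : m ≤ n
  mem : ∀ i, m ≤ i → i ≤ n → σ i ∈ A
  step : ∀ i, m ≤ i → i + 1 ≤ n → σ (i + 1) ∈ F (σ i)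

/-- `σ` is a full solution of `F` in `A`. -/
structure IsFullSolution (F : X → Set X) (A : Set X) (σ : ℤ → X) : Prop where
  mem : ∀ i, σ i ∈ A
  step : ∀ i, σ (i + 1) ∈ F (σ i)

/-- The invariant part of `A`: the points of `A` through which a full solution in `A` passes. -/
def invPart (F : X → Set X) (A : Set X) : Set X :=
  {x | x ∈ A ∧ ∃ σ, IsFullSolution F A σ ∧ ∃ i, σ i = x}

/-- `A` is invariant if through each of its points passes a full solution in `A`. -/
def IsInvariant (F : X → Set X) (A : Set X) : Prop :=
  ∀ x ∈ A, ∃ σ, IsFullSolution F A σ ∧ ∃ i, σ i = x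

variable [TopologicalSpace X]

/-- The closed set `N` is an isolating set for the invariant set `S`. -/
structure IsIsolating (F : X → Set X) (S N : Set X) : Prop where
  invariant : IsInvariant F S
  closed : IsClosed N
  path : ∀ m n σ, IsPath F N m n σ → σ m ∈ S → σ n ∈ S → ∀ i, m ≤ i → i ≤ n → σ i ∈ S
  disjoint : S ∩ closure (image F S \ N) = ∅

/-- `S` is an isolated invariant set. -/
def IsIsolatedInvariant (F : X → Set X) (S : Set X) : Prop :=
  ∃ N, IsIsolating F S N

/-- `P` is an index pair for the isolated invariant set `S` in the isolating set `N`. -/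
structure IsIndexPair (F : X → Set X) (S N : Set X) (P : Set X × Set X) : Prop where
  isolating : IsIsolating F S N
  closed₁ : IsClosed P.1
  closed₂ : IsClosed P.2
  sub : P.2 ⊆ P.1
  sub_N : P.1 ⊆ N
  ip1₁ : image F P.1 ∩ N ⊆ P.1
  ip1₂ : image F P.2 ∩ N ⊆ P.2
  ip2 : P.1 ∩ closure (image F P.1 \ N) ⊆ P.2
  ip3 : S = invPart F (P.1 \ P.2)

/-! ### Index map and Conley index -/

/-- The extended pair `P̄`, with `P̄ᵢ = Pᵢ ∪ cl (F(P₁) \ N)`. -/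
def extend (F : X → Set X) (N : Set X) (P : Set X × Set X) : Set X × Set X :=
  (P.1 ∪ closure (image F P.1 \ N), P.2 ∪ closure (image F P.1 \ N))

/-- The inclusion `ι : P ⟶ P̄`. -/
def extendIncl (F : X → Set X) (N : Set X) (P : Set X × Set X) :
    toPair P ⟶ toPair (extend F N P) :=
  pairMap (ContinuousMap.id X) _ _ (fun _ hx => Or.inl hx) (fun _ hx => Or.inl hx)

/-- The index map `I_P = ι_*⁻¹ ∘ (F_P)_* : H_*(P) ⟶ H_*(P)`, where `F_P : P ⊸ P̄` is the
restriction of `F`. -/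
def indexMap (R : Type u) [Ring R] (F : X → Set X) (N : Set X) (P : Set X × Set X) :
    (relativeHomology.{u, v} R).obj (toPair P) ⟶ (relativeHomology.{u, v} R).obj (toPair P) :=
  inducedMap R F P (extend F N P) ≫ inverse ((relativeHomology.{u, v} R).map (extendIncl F N P))

/-- All ingredients of the index map make sense: `F` maps `P` into `P̄`, and the two homomorphisms
that have to be inverted are isomorphisms. -/
structure IndexMapDefined (R : Type u) [Ring R] (F : X → Set X) (N : Set X)
    (P : Set X × Set X) : Prop where
  maps₁ : image F P.1 ⊆ (extend F N P).1
  maps₂ : image F P.2 ⊆ (extend F N P).2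
  fst_iso : IsIso ((relativeHomology.{u, v} R).map (graphFst F P (extend F N P)))
  incl_iso : IsIso ((relativeHomology.{u, v} R).map (extendIncl F N P))

/-- The object `(H_*(P), I_P)` of `Endo (GrMod R)`. -/
def indexObj (R : Type u) [Ring R] (F : X → Set X) (N : Set X) (P : Set X × Set X) :
    Endo (GrMod.{u, v} R) :=
  ⟨(relativeHomology.{u, v} R).obj (toPair P), indexMap R F N P⟩

/-- An index pair for `S` exists, and for every choice of isolating set and index pair for `S` the
index map is defined. -/
def ConleyIndexDefined (R : Type u) [Ring R] (F : X → Set X) (S : Set X) : Prop :=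
  (∃ N P, IsIndexPair F S N P) ∧ ∀ N P, IsIndexPair F S N P → IndexMapDefined R F N P

/-- `C` is (up to isomorphism) the Conley index `L(H_*(P), I_P)` of `S`, computed from some
isolating set `N` for `S` and some index pair `P` for `S` in `N`. -/
def IsConleyIndex {R : Type u} [Ring R] (L : Endo (GrMod.{u, v} R) ⥤ Auto (GrMod.{u, v} R))
    (F : X → Set X) (S : Set X) (C : Auto (GrMod.{u, v} R)) : Prop :=
  ∃ N P, IsIndexPair F S N P ∧ Nonempty (C ≅ L.obj (indexObj R F N P))

/-! ### Continuation -/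

/-- `(S_F, F)` and `(S_G, G)` are related by an elementary continuation. Multivalued maps are
compared pointwise: `F ≤ G` means `F x ⊆ G x` for all `x`. -/
structure ElementaryContinuation (R : Type u) [Ring R] (F G : X → Set X) (S_F S_G : Set X) :
    Prop where
  admissible_F : IsAdmissible R F
  admissible_G : IsAdmissible R G
  comparable : F ≤ G ∨ G ≤ F
  isolated_F : IsIsolatedInvariant F S_F
  isolated_G : IsIsolatedInvariant G S_G
  pair : ∃ (N_F N_G : Set X) (P : Set X × Set X),
    IsIndexPair F S_F N_F P ∧ IsIndexPair G S_G N_G P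

/-- `S_F` and `S_G` are related by continuation: there are a fence
`F = Φ 0 ≤ Φ 1 ≥ Φ 2 ≤ … Φ k = G` and isolated invariant sets `T i` for `Φ i` from `T 0 = S_F` to
`T k = S_G`, with an elementary continuation at each step. -/
def RelatedByContinuation (R : Type u) [Ring R] (F G : X → Set X) (S_F S_G : Set X) : Prop :=
  ∃ (k : ℕ) (Φ : ℕ → X → Set X) (T : ℕ → Set X),
    Φ 0 = F ∧ Φ k = G ∧ T 0 = S_F ∧ T k = S_G ∧
    (∀ i ≤ k, IsAdmissible R (Φ i) ∧ IsIsolatedInvariant (Φ i) (T i)) ∧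
    (∀ i < k, (Even i → Φ i ≤ Φ (i + 1)) ∧ (Odd i → Φ (i + 1) ≤ Φ i)) ∧
    ∀ i < k, ElementaryContinuation R (Φ i) (Φ (i + 1)) (T i) (T (i + 1))

end Dynamics

end FiniteConley

end

open FiniteConley

/-!
In a finite `T₀` space a multivalued map `F` with closed values is lower semicontinuous if and only
if `F x' ⊆ F x` whenever `x'` lies in the closure of `x`. All topological questions thereby become
questions about the specialization order.

*Homology.* The index map of an index pair is defined because of two isomorphisms.

* The projection of the graph of `F` to its domain is a homology equivalence (`HEquiv.of_graph`, a
  Vietoris theorem). A map to a finite space is a homology equivalence if it is one over all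
  closures of points (`HEquiv.of_closure`), and the part of the graph over the closure of `x`
  retracts to the acyclic set `F x`.
* The inclusion `P ⟶ P̄` is an excision by closed sets, which are excisive in a finite `T₀` space
  (`excisive_of_isClosed`): a double mapping cylinder turns the closed sets into open ones, and its
  projection is a homology equivalence by the analogous criterion for minimal open neighbourhoods
  (`HEquiv.of_nhdsKer`).

Both criteria are inductions by Mayer–Vietoris (`hEquivOver_of_basis`), and the second one rests on
excision for open sets (`PairHEquiv.of_isOpenEmbedding`), which is proved by barycentric
subdivision.

*Independence of the index pair.* For pairs `P ⊆ Q` with `P.1 \ P.2 = Q.1 \ Q.2` the inclusion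
induces an isomorphism that commutes with the index maps (`nonempty_iso_of_diff_eq`). For pairs
`P ⊆ Q` such that `F` maps `Q` into `P`, up to points outside the isolating set, the two index maps
are `φψ` and `ψφ`, where `φ` is induced by the inclusion and `ψ` by `F`; a normal functor sends such
a `φ` to an isomorphism (`nonempty_iso_of_image_subset`). These two moves connect every index pair
in `N` with the canonical one, formed by the points that are reached from `S` in `N` and those of
them outside `S` (`IsIndexPair.nonempty_iso_reach`). Iterated moves of the second kind come to an
end since the space is finite, and they can only get stuck at a set which contains a full solution
and hence a point of `S`, which is impossible. The canonical pairs of two isolating sets are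
compared through that of their intersection.

*Continuation.* In an elementary continuation the two maps share an index pair. If `F ≤ G`, then the
graph of `F` and the extended pair of `F` are contained in those of `G`, so that the index maps on
the shared pair coincide (`indexMap_eq_of_le`).
-/

noncomputable section

namespace FiniteConley

/-! ### Barycentric subdivision of chains of vertex lists -/

section VertexChains

variable {S S' : Type*}

/-- Integral chains of lists of `k` vertices in `S`. A list of `k` vertices stands for a simplex of
dimension `k - 1`, so that the chains of empty lists are the augmentation term. -/
abbrev VertexChain (k : ℕ) (S : Type*) := (Fin k → S) →₀ ℤ

/-- The simplex with the given list of vertices, as a chain. -/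
abbrev vertexSimplex {k : ℕ} (w : Fin k → S) : VertexChain k S := Finsupp.single w 1

/-- The chain map induced by a map of vertices. -/
def vertexMap (g : S → S') (k : ℕ) : VertexChain k S →ₗ[ℤ] VertexChain k S' :=
  Finsupp.lmapDomain ℤ ℤ (g ∘ ·)

/-- The boundary of a chain of vertex lists; in the lowest degree it is the augmentation. -/
def vertexBoundary (k : ℕ) : VertexChain (k + 1) S →ₗ[ℤ] VertexChain k S :=
  ∑ i : Fin (k + 1), (-1 : ℤ) ^ (i : ℕ) • Finsupp.lmapDomain ℤ ℤ i.removeNth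

/-- The cone with apex `b` over a chain. -/
def vertexCone (b : S) (k : ℕ) : VertexChain k S →ₗ[ℤ] VertexChain (k + 1) S :=
  Finsupp.lmapDomain ℤ ℤ (Fin.cons (α := fun _ => S) b)

@[simp] lemma vertexMap_single (g : S → S') {k : ℕ} (w : Fin k → S) :
    vertexMap g k (vertexSimplex w) = vertexSimplex (g ∘ w) := by
  simp [vertexMap, Finsupp.mapDomain_single]

@[simp] lemma vertexCone_single (b : S) {k : ℕ} (w : Fin k → S) :
    vertexCone b k (vertexSimplex w) = vertexSimplex (Fin.cons (α := fun _ => S) b w) := by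
  simp [vertexCone, Finsupp.mapDomain_single]

lemma vertexBoundary_single {k : ℕ} (w : Fin (k + 1) → S) :
    vertexBoundary k (vertexSimplex w) =
      ∑ i : Fin (k + 1), (-1 : ℤ) ^ (i : ℕ) • vertexSimplex (i.removeNth w) := by
  simp only [vertexBoundary, LinearMap.sum_apply, LinearMap.smul_apply, Finsupp.lmapDomain_apply,
    Finsupp.mapDomain_single]

/-- Two linear maps on vertex chains agree if they agree on the simplices. -/
lemma vertexChain_hom_ext {M : Type*} [AddCommGroup M] {k : ℕ} {f g : VertexChain k S →ₗ[ℤ] M}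
    (h : ∀ w : Fin k → S, f (vertexSimplex w) = g (vertexSimplex w)) : f = g :=
  Finsupp.lhom_ext' fun w => LinearMap.ext_ring (h w)

lemma vertexMap_boundary (g : S → S') (k : ℕ) (c : VertexChain (k + 1) S) :
    vertexMap g k (vertexBoundary k c) = vertexBoundary k (vertexMap g (k + 1) c) := by
  revert c
  refine LinearMap.congr_fun (f := vertexMap g k ∘ₗ vertexBoundary k)
    (g := vertexBoundary k ∘ₗ vertexMap g (k + 1)) (vertexChain_hom_ext fun w => ?_)
  simp only [LinearMap.comp_apply, vertexMap_single, vertexBoundary_single, map_sum, map_smul]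
  rfl

lemma vertexMap_cone (g : S → S') (b : S) (k : ℕ) (c : VertexChain k S) :
    vertexMap g (k + 1) (vertexCone b k c) = vertexCone (g b) k (vertexMap g k c) := by
  revert c
  refine LinearMap.congr_fun (f := vertexMap g (k + 1) ∘ₗ vertexCone b k)
    (g := vertexCone (g b) k ∘ₗ vertexMap g k) (vertexChain_hom_ext fun w => ?_)
  simp only [LinearMap.comp_apply, vertexMap_single, vertexCone_single]
  congr 1
  exact Fin.comp_cons g b w

lemma vertexBoundary_cone_zero (b : S) (c : VertexChain 0 S) :
    vertexBoundary 0 (vertexCone b 0 c) = c := by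
  revert c
  refine LinearMap.congr_fun (f := vertexBoundary 0 ∘ₗ vertexCone b 0)
    (g := LinearMap.id) (vertexChain_hom_ext fun w => ?_)
  simp [vertexBoundary_single, Subsingleton.elim _ w]

lemma vertexBoundary_cone (b : S) (k : ℕ) (c : VertexChain (k + 1) S) :
    vertexBoundary (k + 1) (vertexCone b (k + 1) c) = c - vertexCone b k (vertexBoundary k c) := by
  revert c
  refine LinearMap.congr_fun (f := vertexBoundary (k + 1) ∘ₗ vertexCone b (k + 1))
    (g := LinearMap.id - vertexCone b k ∘ₗ vertexBoundary k) (vertexChain_hom_ext fun w => ?_)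
  simp only [LinearMap.comp_apply, LinearMap.sub_apply, vertexCone_single, vertexBoundary_single,
    map_sum, map_smul, LinearMap.id_apply]
  rw [Fin.sum_univ_succ, sub_eq_add_neg, ← Finset.sum_neg_distrib]
  congr 1
  · simp
  · refine Finset.sum_congr rfl fun i _ => ?_
    have : i.succ.removeNth (Fin.cons (α := fun _ => S) b w) =
        Fin.cons (α := fun _ => S) b (i.removeNth w) := Fin.cons_comp_succ_succAbove b w i
    rw [this, Fin.val_succ, pow_succ, mul_neg_one, neg_smul]

lemma vertexBoundary_boundary (k : ℕ) (c : VertexChain (k + 2) S) :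
    vertexBoundary k (vertexBoundary (k + 1) c) = 0 := by
  revert c
  refine LinearMap.congr_fun (f := vertexBoundary k ∘ₗ vertexBoundary (k + 1)) (g := 0)
    (vertexChain_hom_ext fun w => ?_)
  obtain ⟨b, w, rfl⟩ : ∃ b w', w = Fin.cons (α := fun _ => S) b w' :=
    ⟨w 0, Fin.tail w, (Fin.cons_self_tail w).symm⟩
  -- every list of vertices is a cone, so the cone formula gives an induction on the degree
  induction k generalizing b with
  | zero =>
    rw [← vertexCone_single, LinearMap.comp_apply, vertexBoundary_cone, map_sub,
      vertexBoundary_cone_zero, sub_self, LinearMap.zero_apply]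
  | succ k ih =>
    have h : vertexBoundary k (vertexBoundary (k + 1) (vertexSimplex w)) = 0 := by
      have := ih (w 0) (Fin.tail w)
      rwa [Fin.cons_self_tail] at this
    rw [← vertexCone_single, LinearMap.comp_apply, vertexBoundary_cone, map_sub,
      vertexBoundary_cone, h, map_zero, sub_zero, sub_self, LinearMap.zero_apply]

variable (b : ∀ k : ℕ, (Fin k → S) → S) (b' : ∀ k : ℕ, (Fin k → S') → S')

/-- The barycentric subdivision of vertex chains, where `b` chooses the barycenter of a list. It
replaces a simplex by the cone, with apex the barycenter, over the subdivision of the boundary. -/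
def vertexSd : ∀ k : ℕ, VertexChain k S →ₗ[ℤ] VertexChain k S
  | 0 => LinearMap.id
  | k + 1 => Finsupp.linearCombination ℤ fun w =>
      vertexCone (b (k + 1) w) k (vertexSd k (vertexBoundary k (vertexSimplex w)))

/-- The chain homotopy between the identity and the barycentric subdivision. -/
def vertexHtpy : ∀ k : ℕ, VertexChain k S →ₗ[ℤ] VertexChain (k + 1) S
  | 0 => 0
  | k + 1 => Finsupp.linearCombination ℤ fun w =>
      vertexCone (b (k + 1) w) (k + 1)
        (vertexSimplex w - vertexHtpy k (vertexBoundary k (vertexSimplex w)))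

lemma vertexSd_single {k : ℕ} (w : Fin (k + 1) → S) :
    vertexSd b (k + 1) (vertexSimplex w) =
      vertexCone (b (k + 1) w) k (vertexSd b k (vertexBoundary k (vertexSimplex w))) := by
  simp [vertexSd]

lemma vertexHtpy_single {k : ℕ} (w : Fin (k + 1) → S) :
    vertexHtpy b (k + 1) (vertexSimplex w) =
      vertexCone (b (k + 1) w) (k + 1)
        (vertexSimplex w - vertexHtpy b k (vertexBoundary k (vertexSimplex w))) := by
  simp [vertexHtpy]

lemma vertexBoundary_sd (k : ℕ) (c : VertexChain (k + 1) S) :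
    vertexBoundary k (vertexSd b (k + 1) c) = vertexSd b k (vertexBoundary k c) := by
  induction k with
  | zero =>
    revert c
    refine LinearMap.congr_fun (f := vertexBoundary 0 ∘ₗ vertexSd b 1)
      (g := vertexSd b 0 ∘ₗ vertexBoundary 0) (vertexChain_hom_ext fun w => ?_)
    rw [LinearMap.comp_apply, LinearMap.comp_apply, vertexSd_single, vertexBoundary_cone_zero]
  | succ k ih =>
    revert c
    refine LinearMap.congr_fun (f := vertexBoundary (k + 1) ∘ₗ vertexSd b (k + 2))
      (g := vertexSd b (k + 1) ∘ₗ vertexBoundary (k + 1)) (vertexChain_hom_ext fun w => ?_)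
    rw [LinearMap.comp_apply, LinearMap.comp_apply, vertexSd_single, vertexBoundary_cone, ih,
      vertexBoundary_boundary, map_zero, map_zero, sub_zero]

lemma vertexBoundary_htpy_zero (c : VertexChain 0 S) :
    vertexBoundary 0 (vertexHtpy b 0 c) = c - vertexSd b 0 c := by
  simp [vertexHtpy, vertexSd]

/-- The recursive definition of the homotopy `T` makes `∂T + T∂ = 1 - sd` in degree `k + 1` a formal
consequence of the same identity in degree `k`. -/
lemma vertexBoundary_htpy (k : ℕ) (c : VertexChain (k + 1) S) :
    vertexBoundary (k + 1) (vertexHtpy b (k + 1) c) =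
      c - vertexSd b (k + 1) c - vertexHtpy b k (vertexBoundary k c) := by
  have step : ∀ k, (∀ c : VertexChain (k + 1) S,
      vertexBoundary k (vertexHtpy b k (vertexBoundary k c)) =
        vertexBoundary k c - vertexSd b k (vertexBoundary k c)) →
      ∀ c : VertexChain (k + 1) S, vertexBoundary (k + 1) (vertexHtpy b (k + 1) c) =
        c - vertexSd b (k + 1) c - vertexHtpy b k (vertexBoundary k c) := by
    intro k h
    refine LinearMap.congr_fun (f := vertexBoundary (k + 1) ∘ₗ vertexHtpy b (k + 1))
      (g := LinearMap.id - vertexSd b (k + 1) - vertexHtpy b k ∘ₗ vertexBoundary k)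
      (vertexChain_hom_ext fun w => ?_)
    rw [LinearMap.comp_apply, vertexHtpy_single, vertexBoundary_cone, map_sub, h, sub_sub_cancel,
      ← vertexSd_single]
    simp only [LinearMap.sub_apply, LinearMap.id_apply, LinearMap.comp_apply]
    abel
  induction k with
  | zero => exact step 0 (fun c => vertexBoundary_htpy_zero b _) c
  | succ k ih =>
    refine step (k + 1) (fun c => ?_) c
    rw [ih, vertexBoundary_boundary, map_zero, sub_zero]

variable {b b'}

/-- Subdivision is natural for maps of vertices that preserve barycenters. -/
lemma vertexMap_sd {g : S → S'}
    (hg : ∀ k (w : Fin (k + 1) → S), g (b (k + 1) w) = b' (k + 1) (g ∘ w))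
    (k : ℕ) (c : VertexChain k S) :
    vertexMap g k (vertexSd b k c) = vertexSd b' k (vertexMap g k c) := by
  induction k with
  | zero => rfl
  | succ k ih =>
    revert c
    refine LinearMap.congr_fun (f := vertexMap g (k + 1) ∘ₗ vertexSd b (k + 1))
      (g := vertexSd b' (k + 1) ∘ₗ vertexMap g (k + 1)) (vertexChain_hom_ext fun w => ?_)
    rw [LinearMap.comp_apply, LinearMap.comp_apply, vertexSd_single, vertexMap_cone, ih,
      vertexMap_single, vertexSd_single, vertexMap_boundary, vertexMap_single, hg]

lemma vertexMap_htpy {g : S → S'}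
    (hg : ∀ k (w : Fin (k + 1) → S), g (b (k + 1) w) = b' (k + 1) (g ∘ w))
    (k : ℕ) (c : VertexChain k S) :
    vertexMap g (k + 1) (vertexHtpy b k c) = vertexHtpy b' k (vertexMap g k c) := by
  induction k with
  | zero => simp [vertexHtpy]
  | succ k ih =>
    revert c
    refine LinearMap.congr_fun (f := vertexMap g (k + 2) ∘ₗ vertexHtpy b (k + 1))
      (g := vertexHtpy b' (k + 1) ∘ₗ vertexMap g (k + 1)) (vertexChain_hom_ext fun w => ?_)
    rw [LinearMap.comp_apply, LinearMap.comp_apply, vertexHtpy_single, vertexMap_cone, map_sub, ih,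
      vertexMap_single, vertexHtpy_single, vertexMap_boundary, vertexMap_single, hg]

end VertexChains

/-! ### Affine simplices in a standard simplex -/

section Affine

variable {k l m : ℕ}

/-- The affine map between standard simplices with prescribed values at the vertices. -/
def affineSimplex (w : Fin k → stdSimplex ℝ (Fin m)) :
    C(stdSimplex ℝ (Fin k), stdSimplex ℝ (Fin m)) where
  toFun t := ⟨fun i => ∑ j, t j * w j i,
    fun i => Finset.sum_nonneg fun j _ => mul_nonneg (stdSimplex.zero_le t j)
      (stdSimplex.zero_le (w j) i), by
    rw [Finset.sum_comm]
    simp [← Finset.mul_sum]⟩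
  continuous_toFun := by
    refine Continuous.subtype_mk (continuous_pi fun i => continuous_finsetSum _ fun j _ => ?_) _
    exact ((continuous_apply j).comp continuous_subtype_val).mul continuous_const

lemma affineSimplex_apply (w : Fin k → stdSimplex ℝ (Fin m)) (t : stdSimplex ℝ (Fin k))
    (i : Fin m) : affineSimplex w t i = ∑ j, t j * w j i := rfl

@[simp] lemma affineSimplex_vertex (w : Fin k → stdSimplex ℝ (Fin m)) (j : Fin k) :
    affineSimplex w (stdSimplex.vertex j) = w j := by
  ext i
  simp [affineSimplex_apply, Pi.single_apply]

@[simp] lemma affineSimplex_comp_vertex (w : Fin k → stdSimplex ℝ (Fin m)) :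
    affineSimplex w ∘ stdSimplex.vertex = w :=
  funext fun j => affineSimplex_vertex w j

@[simp] lemma affineSimplex_id :
    affineSimplex (stdSimplex.vertex : Fin k → stdSimplex ℝ (Fin k)) = ContinuousMap.id _ := by
  ext t i
  simp [affineSimplex_apply, Pi.single_apply]

lemma affineSimplex_comp (w : Fin l → stdSimplex ℝ (Fin m)) (u : Fin k → stdSimplex ℝ (Fin l)) :
    (affineSimplex w).comp (affineSimplex u) = affineSimplex (affineSimplex w ∘ u) := by
  ext t i
  simp only [ContinuousMap.comp_apply, affineSimplex_apply, Function.comp_apply, Finset.sum_mul,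
    Finset.mul_sum]
  rw [Finset.sum_comm]
  simp only [mul_assoc]

lemma stdSimplex_map_eq_affineSimplex (f : Fin k → Fin m) (t : stdSimplex ℝ (Fin k)) :
    stdSimplex.map f t = affineSimplex (fun j => stdSimplex.vertex (f j)) t := by
  ext i
  simp [affineSimplex_apply, FunOnFinite.linearMap_apply_apply, Pi.single_apply, Finset.sum_filter,
    eq_comm]

/-- The barycenter of a list of points. The empty list has no barycenter and is given an arbitrary
value, which does not enter into the subdivision. -/
def barycenterOf (m : ℕ) (k : ℕ) (w : Fin k → stdSimplex ℝ (Fin (m + 1))) :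
    stdSimplex ℝ (Fin (m + 1)) :=
  match k, w with
  | 0, _ => stdSimplex.vertex 0
  | _ + 1, w => affineSimplex w stdSimplex.barycenter

lemma affineSimplex_barycenterOf {l m : ℕ} (w : Fin (l + 1) → stdSimplex ℝ (Fin (m + 1))) (k : ℕ)
    (u : Fin (k + 1) → stdSimplex ℝ (Fin (l + 1))) :
    affineSimplex w (barycenterOf l (k + 1) u) =
      barycenterOf m (k + 1) (affineSimplex w ∘ u) :=
  DFunLike.congr_fun (affineSimplex_comp w u) stdSimplex.barycenter

lemma stdSimplex_dist_le_iff {s t : stdSimplex ℝ (Fin m)} {r : ℝ} (hr : 0 ≤ r) :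
    dist s t ≤ r ↔ ∀ i, |s i - t i| ≤ r := by
  rw [Subtype.dist_eq, dist_pi_le_iff hr]
  rfl

/-- A point whose distance to all vertices of an affine simplex is at most `r` has distance at most
`r` to all points of that simplex. -/
lemma dist_affineSimplex_le {w : Fin k → stdSimplex ℝ (Fin m)} {p : stdSimplex ℝ (Fin m)} {r : ℝ}
    (hr : 0 ≤ r) (h : ∀ j, dist p (w j) ≤ r) (t : stdSimplex ℝ (Fin k)) :
    dist p (affineSimplex w t) ≤ r := by
  rw [stdSimplex_dist_le_iff hr]
  intro i
  have h₁ : p i - affineSimplex w t i = ∑ j, t j * (p i - w j i) := by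
    simp only [mul_sub, Finset.sum_sub_distrib, ← Finset.sum_mul, affineSimplex_apply,
      stdSimplex.sum_eq_one, one_mul]
  rw [h₁]
  calc |∑ j, t j * (p i - w j i)| ≤ ∑ j, |t j * (p i - w j i)| := Finset.abs_sum_le_sum_abs _ _
    _ ≤ ∑ j, t j * r := by
        refine Finset.sum_le_sum fun j _ => ?_
        rw [abs_mul, abs_of_nonneg (stdSimplex.zero_le t j)]
        exact mul_le_mul_of_nonneg_left ((stdSimplex_dist_le_iff hr).1 (h j) i)
          (stdSimplex.zero_le t j)
    _ = r := by rw [← Finset.sum_mul, stdSimplex.sum_eq_one, one_mul]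

/-- The barycenter of `k + 1` points at mutual distance at most `D` has distance at most
`k / (k + 1) * D` to each of them. -/
lemma dist_barycenterOf_le {w : Fin (k + 1) → stdSimplex ℝ (Fin (m + 1))} {D : ℝ} (hD : 0 ≤ D)
    (h : ∀ i j, dist (w i) (w j) ≤ D) (j : Fin (k + 1)) :
    dist (barycenterOf m (k + 1) w) (w j) ≤ k / (k + 1) * D := by
  have hk : (0 : ℝ) < k + 1 := by positivity
  rw [stdSimplex_dist_le_iff (by positivity)]
  intro i
  have h₁ : barycenterOf m (k + 1) w i - w j i = (k + 1 : ℝ)⁻¹ * ∑ l, (w l i - w j i) := by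
    have h₂ : barycenterOf m (k + 1) w i = (k + 1 : ℝ)⁻¹ * ∑ l, w l i := by
      change ∑ l, (stdSimplex.barycenter : stdSimplex ℝ (Fin (k + 1))).val l * w l i = _
      simp [Finset.mul_sum]
    rw [h₂, Finset.sum_sub_distrib, mul_sub]
    simp
    field_simp
  rw [h₁, abs_mul, abs_of_pos (inv_pos.2 hk), div_eq_inv_mul, mul_assoc]
  refine mul_le_mul_of_nonneg_left ?_ (inv_pos.2 hk).le
  rw [Fin.sum_univ_succAbove _ j, sub_self, zero_add]
  calc |∑ l : Fin k, (w (j.succAbove l) i - w j i)|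
      ≤ ∑ l : Fin k, |w (j.succAbove l) i - w j i| := Finset.abs_sum_le_sum_abs _ _
    _ ≤ ∑ _l : Fin k, D := Finset.sum_le_sum fun l _ => (stdSimplex_dist_le_iff hD).1 (h _ _) i
    _ = k * D := by simp

/-- The chains of vertex lists whose vertices have mutual distance at most `D`. -/
def smallChains (m k : ℕ) (D : ℝ) : Submodule ℤ (VertexChain k (stdSimplex ℝ (Fin m))) :=
  Finsupp.supported ℤ ℤ {w | ∀ i j, dist (w i) (w j) ≤ D}

/-- The simplices in the subdivision of a simplex `w` lie in `w`, and their diameters are at most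
`(k - 1) / k` times the bound `D` for that of `w`. -/
lemma vertexSd_mem_supported (k : ℕ) (w : Fin k → stdSimplex ℝ (Fin (m + 1))) {D : ℝ} (hD : 0 ≤ D)
    (h : ∀ i j, dist (w i) (w j) ≤ D) :
    vertexSd (barycenterOf m) k (vertexSimplex w) ∈ Finsupp.supported ℤ ℤ
      {u : Fin k → stdSimplex ℝ (Fin (m + 1)) |
        (∀ j, u j ∈ Set.range (affineSimplex w)) ∧ ∀ i j, dist (u i) (u j) ≤ (k - 1) / k * D} := by
  induction k with
  | zero => exact Finsupp.single_mem_supported ℤ 1 ⟨fun j => j.elim0, fun j => j.elim0⟩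
  | succ k ih =>
    rw [vertexSd_single, vertexBoundary_single]
    simp only [map_sum, map_smul]
    refine Submodule.sum_mem _ fun i _ => Submodule.smul_mem _ _ ?_
    have hi := ih (i.removeNth w) fun _ _ => h _ _
    have hi' := Submodule.mem_map_of_mem (f := vertexCone (barycenterOf m (k + 1) w) k) hi
    rw [vertexCone, Finsupp.lmapDomain_supported] at hi'
    refine Finsupp.supported_mono ?_ hi'
    rintro _ ⟨u, ⟨hu₁, hu₂⟩, rfl⟩
    -- the simplices of the subdivision are the cones from the barycenter over the simplices `u` of
    -- the subdivided face opposite to the vertex `i`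
    have hu₃ : ∀ j, u j ∈ Set.range (affineSimplex w) := by
      intro j
      obtain ⟨t, ht⟩ := hu₁ j
      refine ⟨affineSimplex (fun l => stdSimplex.vertex (i.succAbove l)) t, ?_⟩
      rw [← ContinuousMap.comp_apply, affineSimplex_comp, ← ht]
      congr 2
      funext l
      exact affineSimplex_vertex _ _
    have hd : ∀ j, dist (barycenterOf m (k + 1) w) (u j) ≤ k / (k + 1) * D := by
      intro j
      obtain ⟨t, ht⟩ := hu₃ j
      rw [← ht]
      exact dist_affineSimplex_le (by positivity) (dist_barycenterOf_le hD h) t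
    have hk : ((k + 1 : ℕ) - 1 : ℝ) / ((k + 1 : ℕ) : ℝ) = k / (k + 1) := by push_cast; ring
    refine ⟨fun j => ?_, fun j l => ?_⟩
    · induction j using Fin.cases with
      | zero => exact ⟨stdSimplex.barycenter, rfl⟩
      | succ j => exact hu₃ j
    · rw [hk]
      induction j using Fin.cases with
      | zero =>
        induction l using Fin.cases with
        | zero => simp only [dist_self]; positivity
        | succ l => exact hd l
      | succ j =>
        induction l using Fin.cases with
        | zero => rw [dist_comm]; exact hd j
        | succ l =>
          refine (hu₂ j l).trans (mul_le_mul_of_nonneg_right ?_ hD)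
          have : (0 : ℝ) < k := by exact_mod_cast (Fin.pos j)
          rw [div_le_div_iff₀ this (by positivity)]
          nlinarith

lemma vertexSd_smallChains (k : ℕ) {D : ℝ} (hD : 0 ≤ D)
    {c : VertexChain k (stdSimplex ℝ (Fin (m + 1)))} (hc : c ∈ smallChains (m + 1) k D) :
    vertexSd (barycenterOf m) k c ∈ smallChains (m + 1) k ((k - 1) / k * D) := by
  rw [← c.sum_single, Finsupp.sum, map_sum]
  refine Submodule.sum_mem _ fun w hw => ?_
  have : (Finsupp.single w (c w) : VertexChain k _) = c w • vertexSimplex w := by simp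
  rw [this, map_smul]
  exact Submodule.smul_mem _ _ (Finsupp.supported_mono (fun u hu => hu.2)
    (vertexSd_mem_supported k w hD (hc hw)))

/-- Iterated barycentric subdivisions of a simplex become arbitrarily fine. -/
lemma exists_vertexSd_iterate_mem_smallChains (k : ℕ) {ε : ℝ} (hε : 0 < ε)
    (w : Fin (k + 1) → stdSimplex ℝ (Fin (m + 1))) :
    ∃ r₀, ∀ r ≥ r₀, (vertexSd (barycenterOf m) (k + 1))^[r] (vertexSimplex w) ∈
      smallChains (m + 1) (k + 1) ε := by
  set q : ℝ := k / (k + 1)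
  have hq₀ : 0 ≤ q := by positivity
  have hq₁ : q < 1 := by
    rw [div_lt_one (by positivity)]
    linarith
  have h : ∀ r, (vertexSd (barycenterOf m) (k + 1))^[r] (vertexSimplex w) ∈
      smallChains (m + 1) (k + 1) (q ^ r) := by
    intro r
    induction r with
    | zero =>
      refine Finsupp.single_mem_supported ℤ 1 fun i j => ?_
      rw [pow_zero, stdSimplex_dist_le_iff zero_le_one]
      intro l
      rw [abs_sub_le_iff]
      constructor <;>
        linarith [stdSimplex.le_one (w i) l, stdSimplex.le_one (w j) l,
          stdSimplex.zero_le (w i) l, stdSimplex.zero_le (w j) l]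
    | succ r ih =>
      have := vertexSd_smallChains (k + 1) (pow_nonneg hq₀ r) ih
      rw [Function.iterate_succ_apply', pow_succ']
      convert this using 3
      simp [q]
  obtain ⟨r₀, hr₀⟩ := exists_pow_lt_of_lt_one hε hq₁
  refine ⟨r₀, fun r hr => Finsupp.supported_mono (fun u hu i j => (hu i j).trans ?_) (h r)⟩
  exact (pow_le_pow_of_le_one hq₀ hq₁.le hr).trans hr₀.le

end Affine

/-! ### Subdivision of singular chains -/

section SingularSubdivision

open Simplicial

/-- The singular simplex given by a continuous map on a standard simplex. -/
def singularSimplex {X : TopCat.{v}} {n : ℕ} (σ : C(stdSimplex ℝ (Fin (n + 1)), X)) :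
    (TopCat.toSSet.obj X) _⦋n⦌ :=
  (TopCat.toSSetObjEquiv X (.op ⦋n⦌)).symm σ

lemma singularSimplex_surjective {X : TopCat.{v}} {n : ℕ} (s : (TopCat.toSSet.obj X) _⦋n⦌) :
    ∃ σ : C(stdSimplex ℝ (Fin (n + 1)), X), singularSimplex σ = s :=
  ⟨TopCat.toSSetObjEquiv X (.op ⦋n⦌) s, Equiv.symm_apply_apply _ _⟩

lemma δ_singularSimplex {X : TopCat.{v}} {n : ℕ} (σ : C(stdSimplex ℝ (Fin (n + 2)), X))
    (i : Fin (n + 2)) :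
    (TopCat.toSSet.obj X).δ i (singularSimplex σ) = singularSimplex
      (σ.comp (affineSimplex fun j => stdSimplex.vertex (i.succAbove j))) := by
  apply (TopCat.toSSetObjEquiv X (.op ⦋n⦌)).injective
  ext t
  change σ (stdSimplex.map _ t) = σ _
  rw [stdSimplex_map_eq_affineSimplex]
  rfl

variable {C : Type*} [Category* C] [Preadditive C] [Limits.HasCoproducts.{v} C]
variable (R : C)

/-- The singular chain complex of a space with coefficients in an object `R`. -/
abbrev singularChains (X : TopCat.{v}) : ChainComplex C ℕ :=
  ((AlgebraicTopology.singularChainComplexFunctor C).obj R).obj X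

/-- The chain map induced by a continuous map. -/
abbrev singularMap {X Y : TopCat.{v}} (f : X ⟶ Y) : singularChains R X ⟶ singularChains R Y :=
  ((AlgebraicTopology.singularChainComplexFunctor C).obj R).map f

/-- The inclusion of the summand given by a singular simplex. -/
def simplexι {X : TopCat.{v}} {n : ℕ} (σ : C(stdSimplex ℝ (Fin (n + 1)), X)) :
    R ⟶ (singularChains R X).X n :=
  (TopCat.toSSet.obj X).ιChainComplex (singularSimplex σ)

variable {R}

lemma singularChains_hom_ext {X : TopCat.{v}} {n : ℕ} {T : C}
    {f g : (singularChains R X).X n ⟶ T}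
    (h : ∀ σ : C(stdSimplex ℝ (Fin (n + 1)), X), simplexι R σ ≫ f = simplexι R σ ≫ g) : f = g := by
  apply SSet.chainComplex_hom_ext
  intro s
  obtain ⟨σ, rfl⟩ := singularSimplex_surjective s
  exact h σ

variable (R) in
/-- The morphism out of the singular chains with prescribed values on the simplices. -/
def singularDesc {X : TopCat.{v}} {n : ℕ} {T : C}
    (φ : C(stdSimplex ℝ (Fin (n + 1)), X) → (R ⟶ T)) : (singularChains R X).X n ⟶ T :=
  Limits.Sigma.desc fun s => φ (TopCat.toSSetObjEquiv X (.op ⦋n⦌) s)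

@[simp]
lemma simplexι_desc {X : TopCat.{v}} {n : ℕ} {T : C}
    (φ : C(stdSimplex ℝ (Fin (n + 1)), X) → (R ⟶ T)) (σ : C(stdSimplex ℝ (Fin (n + 1)), X)) :
    simplexι R σ ≫ singularDesc R φ = φ σ := by
  have := Limits.Sigma.ι_desc (fun s => φ (TopCat.toSSetObjEquiv X (.op ⦋n⦌) s))
    (singularSimplex σ)
  rwa [singularSimplex, Equiv.apply_symm_apply] at this

lemma simplexι_map {X Y : TopCat.{v}} (f : X ⟶ Y) {n : ℕ}
    (σ : C(stdSimplex ℝ (Fin (n + 1)), X)) :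
    simplexι R σ ≫ (singularMap R f).f n = simplexι R (f.hom.comp σ) :=
  SSet.ι_chainComplexMap_f _ _ (TopCat.toSSet.map f) R (singularSimplex σ)

lemma simplexι_d {X : TopCat.{v}} {n : ℕ} (σ : C(stdSimplex ℝ (Fin (n + 2)), X)) :
    simplexι R σ ≫ (singularChains R X).d (n + 1) n = ∑ i : Fin (n + 2), (-1 : ℤ) ^ (i : ℕ) •
      simplexι R (σ.comp (affineSimplex fun j => stdSimplex.vertex (i.succAbove j))) := by
  simp only [simplexι, ← δ_singularSimplex]
  exact SSet.ιChainComplex_d _ R (singularSimplex σ)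

variable (R) in
/-- The singular chain obtained by composing the affine simplices of a vertex chain of a standard
simplex with a continuous map `σ`. -/
def realize {X : TopCat.{v}} {n : ℕ} (σ : C(stdSimplex ℝ (Fin (n + 1)), X)) (k : ℕ) :
    VertexChain (k + 1) (stdSimplex ℝ (Fin (n + 1))) →ₗ[ℤ] (R ⟶ (singularChains R X).X k) :=
  Finsupp.linearCombination ℤ fun w => simplexι R (σ.comp (affineSimplex w))

variable {X Y : TopCat.{v}} {n k : ℕ} (σ : C(stdSimplex ℝ (Fin (n + 1)), X))

@[simp] lemma realize_single (w : Fin (k + 1) → stdSimplex ℝ (Fin (n + 1))) :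
    realize R σ k (vertexSimplex w) = simplexι R (σ.comp (affineSimplex w)) := by
  simp [realize]

lemma realize_vertex : realize R σ n (vertexSimplex stdSimplex.vertex) = simplexι R σ := by
  simp

lemma realize_d (c : VertexChain (k + 2) (stdSimplex ℝ (Fin (n + 1)))) :
    realize R σ (k + 1) c ≫ (singularChains R X).d (k + 1) k =
      realize R σ k (vertexBoundary (k + 1) c) := by
  revert c
  refine LinearMap.congr_fun
    (f := (Preadditive.rightComp R ((singularChains R X).d (k + 1) k)).toIntLinearMap ∘ₗ
      realize R σ (k + 1))
    (g := realize R σ k ∘ₗ vertexBoundary (k + 1)) (vertexChain_hom_ext fun w => ?_)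
  change realize R σ (k + 1) (vertexSimplex w) ≫ _ = realize R σ k (vertexBoundary _ _)
  rw [realize_single, simplexι_d, vertexBoundary_single, map_sum]
  refine Finset.sum_congr rfl fun i _ => ?_
  rw [map_smul, realize_single, ContinuousMap.comp_assoc, affineSimplex_comp]
  congr 4
  exact funext fun j => affineSimplex_vertex _ _

lemma realize_map (f : X ⟶ Y) (c : VertexChain (k + 1) (stdSimplex ℝ (Fin (n + 1)))) :
    realize R σ k c ≫ (singularMap R f).f k = realize R (f.hom.comp σ) k c := by
  revert c
  refine LinearMap.congr_fun
    (f := (Preadditive.rightComp R ((singularMap R f).f k)).toIntLinearMap ∘ₗ realize R σ k)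
    (g := realize R (f.hom.comp σ) k) (vertexChain_hom_ext fun w => ?_)
  change realize R σ k (vertexSimplex w) ≫ _ = _
  rw [realize_single, realize_single, simplexι_map, ContinuousMap.comp_assoc]

lemma realize_comp_affine {l : ℕ} (w : Fin (l + 1) → stdSimplex ℝ (Fin (n + 1)))
    (c : VertexChain (k + 1) (stdSimplex ℝ (Fin (l + 1)))) :
    realize R (σ.comp (affineSimplex w)) k c = realize R σ k (vertexMap (affineSimplex w) _ c) := by
  revert c
  refine LinearMap.congr_fun (f := realize R (σ.comp (affineSimplex w)) k)
    (g := realize R σ k ∘ₗ vertexMap (affineSimplex w) (k + 1)) (vertexChain_hom_ext fun u => ?_)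
  rw [LinearMap.comp_apply, vertexMap_single, realize_single, realize_single,
    ContinuousMap.comp_assoc, affineSimplex_comp]

variable (R X n)

/-- The natural barycentric subdivision of singular chains. -/
def singularSd : (singularChains R X).X n ⟶ (singularChains R X).X n :=
  singularDesc R fun σ =>
    realize R σ n (vertexSd (barycenterOf n) (n + 1) (vertexSimplex stdSimplex.vertex))

/-- The natural chain homotopy between the identity and the barycentric subdivision. -/
def singularHtpy : (singularChains R X).X n ⟶ (singularChains R X).X (n + 1) :=
  singularDesc R fun σ =>
    realize R σ (n + 1) (vertexHtpy (barycenterOf n) (n + 1) (vertexSimplex stdSimplex.vertex))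

variable {R X n}

lemma simplexι_sd : simplexι R σ ≫ singularSd R X n =
    realize R σ n (vertexSd (barycenterOf n) (n + 1) (vertexSimplex stdSimplex.vertex)) :=
  simplexι_desc _ _

lemma simplexι_htpy : simplexι R σ ≫ singularHtpy R X n =
    realize R σ (n + 1) (vertexHtpy (barycenterOf n) (n + 1) (vertexSimplex stdSimplex.vertex)) :=
  simplexι_desc _ _

lemma realize_sd (c : VertexChain (k + 1) (stdSimplex ℝ (Fin (n + 1)))) :
    realize R σ k c ≫ singularSd R X k = realize R σ k (vertexSd (barycenterOf n) (k + 1) c) := by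
  revert c
  refine LinearMap.congr_fun
    (f := (Preadditive.rightComp R (singularSd R X k)).toIntLinearMap ∘ₗ realize R σ k)
    (g := realize R σ k ∘ₗ vertexSd (barycenterOf n) (k + 1)) (vertexChain_hom_ext fun w => ?_)
  change realize R σ k (vertexSimplex w) ≫ _ = realize R σ k _
  rw [realize_single, simplexι_sd, realize_comp_affine,
    vertexMap_sd (b' := barycenterOf n) (fun k u => affineSimplex_barycenterOf w k u),
    vertexMap_single, affineSimplex_comp_vertex]

lemma realize_htpy (c : VertexChain (k + 1) (stdSimplex ℝ (Fin (n + 1)))) :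
    realize R σ k c ≫ singularHtpy R X k =
      realize R σ (k + 1) (vertexHtpy (barycenterOf n) (k + 1) c) := by
  revert c
  refine LinearMap.congr_fun
    (f := (Preadditive.rightComp R (singularHtpy R X k)).toIntLinearMap ∘ₗ realize R σ k)
    (g := realize R σ (k + 1) ∘ₗ vertexHtpy (barycenterOf n) (k + 1))
    (vertexChain_hom_ext fun w => ?_)
  change realize R σ k (vertexSimplex w) ≫ _ = realize R σ (k + 1) _
  rw [realize_single, simplexι_htpy, realize_comp_affine,
    vertexMap_htpy (b' := barycenterOf n) (fun k u => affineSimplex_barycenterOf w k u),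
    vertexMap_single, affineSimplex_comp_vertex]

variable (R X n)

lemma singularSd_d : singularSd R X (n + 1) ≫ (singularChains R X).d (n + 1) n =
    (singularChains R X).d (n + 1) n ≫ singularSd R X n := by
  refine singularChains_hom_ext fun σ => ?_
  rw [← realize_vertex σ, ← Category.assoc, ← Category.assoc, realize_sd, realize_d, realize_d,
    realize_sd, vertexBoundary_sd]

lemma singularHtpy_d_zero : singularHtpy R X 0 ≫ (singularChains R X).d 1 0 =
    𝟙 _ - singularSd R X 0 := by
  refine singularChains_hom_ext fun σ => ?_
  rw [← realize_vertex σ, ← Category.assoc, realize_htpy, realize_d, vertexBoundary_htpy,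
    Preadditive.comp_sub, realize_sd, Category.comp_id, map_sub, map_sub]
  simp [vertexHtpy]

lemma singularHtpy_d_succ : singularHtpy R X (n + 1) ≫ (singularChains R X).d (n + 2) (n + 1) =
    𝟙 _ - singularSd R X (n + 1) - (singularChains R X).d (n + 1) n ≫ singularHtpy R X n := by
  refine singularChains_hom_ext fun σ => ?_
  rw [← realize_vertex σ, ← Category.assoc, realize_htpy, realize_d, vertexBoundary_htpy,
    Preadditive.comp_sub, Preadditive.comp_sub, ← Category.assoc, realize_d, realize_htpy,
    realize_sd, Category.comp_id, map_sub, map_sub]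

variable {X}

lemma singularMap_sd (f : X ⟶ Y) :
    (singularMap R f).f n ≫ singularSd R Y n = singularSd R X n ≫ (singularMap R f).f n := by
  refine singularChains_hom_ext fun σ => ?_
  rw [← Category.assoc, ← Category.assoc, simplexι_map, simplexι_sd, simplexι_sd, realize_map]

lemma singularMap_htpy (f : X ⟶ Y) : (singularMap R f).f n ≫ singularHtpy R Y n =
    singularHtpy R X n ≫ (singularMap R f).f (n + 1) := by
  refine singularChains_hom_ext fun σ => ?_
  rw [← Category.assoc, ← Category.assoc, simplexι_map, simplexι_htpy, simplexι_htpy, realize_map]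

end SingularSubdivision

/-! ### Criteria for quasi-isomorphisms -/

section QuasiIsoLemmas

open HomologicalComplex HomologySequence ComposableArrows Abelian

/-- Five lemma for the middle terms: the counterpart of Mathlib's `quasiIso_τ₃`. -/
lemma quasiIso_middle {A : Type*} [Category* A] [Abelian A]
    {S₁ S₂ : ShortComplex (ChainComplex A ℕ)} (φ : S₁ ⟶ S₂) (hS₁ : S₁.ShortExact)
    (hS₂ : S₂.ShortExact) (h₁ : QuasiIso φ.τ₁) (h₃ : QuasiIso φ.τ₃) : QuasiIso φ.τ₂ := by
  rw [quasiIso_iff]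
  intro i
  rw [quasiIsoAt_iff_isIso_homologyMap]
  have hm : Mono (homologyMap φ.τ₂ i) := by
    have hij : (ComplexShape.down ℕ).Rel (i + 1) i := rfl
    refine mono_of_epi_of_mono_of_mono'' (k := 2) (n := 5) (by lia)
      (composableArrows₅_exact hS₁ (i + 1) i hij) (composableArrows₅_exact hS₂ (i + 1) i hij)
      (mapComposableArrows₅ φ hS₁ hS₂ (i + 1) i hij) 2 3 4 5 rfl rfl rfl rfl ?_ ?_ ?_
    · change Epi (homologyMap φ.τ₃ (i + 1))
      infer_instance
    · change Mono (homologyMap φ.τ₁ i)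
      infer_instance
    · change Mono (homologyMap φ.τ₃ i)
      infer_instance
  have he : Epi (homologyMap φ.τ₂ i) := by
    cases i with
    | zero =>
      refine epi_of_epi_of_epi_of_epi (mapComposableArrows₂ φ 0) (composableArrows₂_exact hS₂ 0)
        ?_ ?_ ?_
      · have := hS₁.epi_g
        exact epi_homologyMap_of_epi_of_not_rel S₁.g 0 (by simp)
      · change Epi (homologyMap φ.τ₁ 0)
        infer_instance
      · change Epi (homologyMap φ.τ₃ 0)
        infer_instance
    | succ i =>
      have hij : (ComplexShape.down ℕ).Rel (i + 1) i := rfl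
      refine epi_of_epi_of_epi_of_mono'' (k := 0) (n := 5) (by lia)
        (composableArrows₅_exact hS₁ (i + 1) i hij) (composableArrows₅_exact hS₂ (i + 1) i hij)
        (mapComposableArrows₅ φ hS₁ hS₂ (i + 1) i hij) 0 1 2 3 rfl rfl rfl rfl ?_ ?_ ?_
      · change Epi (homologyMap φ.τ₁ (i + 1))
        infer_instance
      · change Epi (homologyMap φ.τ₃ (i + 1))
        infer_instance
      · change Mono (homologyMap φ.τ₁ i)
        infer_instance
  exact isIso_of_mono_of_epi _

lemma quasiIso_of_acyclic_cokernel {A : Type*} [Category* A] [Abelian A]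
    {S : ShortComplex (ChainComplex A ℕ)} (hS : S.ShortExact) (h : S.X₃.Acyclic) :
    QuasiIso S.f := by
  rw [quasiIso_iff]
  intro i
  rw [quasiIsoAt_iff_isIso_homologyMap]
  have hz : ∀ j, Limits.IsZero (S.X₃.homology j) := fun j =>
    (exactAt_iff_isZero_homology _ _).1 (h j)
  have hm : Mono (homologyMap S.f i) :=
    (hS.homology_exact₁ (i + 1) i rfl).mono_g ((hz (i + 1)).eq_of_src _ _)
  have he : Epi (homologyMap S.f i) :=
    (hS.homology_exact₂ i).epi_f ((hz i).eq_of_tgt _ _)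
  exact isIso_of_mono_of_epi _

/-- A degreewise injective chain map `f : K ⟶ L` is a quasi-isomorphism if every chain of `L` whose
boundary comes from `K` comes from `K` up to a boundary. -/
lemma quasiIso_of_injective {S : Type u} [Ring S] {K L : ChainComplex (ModuleCat.{v} S) ℕ}
    (f : K ⟶ L)
    (hinj : ∀ n, Function.Injective (f.f n))
    (h : ∀ n (z : L.X n), (∀ m, L.d n m z ∈ Set.range (f.f m)) →
      ∃ w, z - L.d (n + 1) n w ∈ Set.range (f.f n)) : QuasiIso f := by
  have : ∀ n, Mono (f.f n) := fun n => (ModuleCat.mono_iff_injective _).2 (hinj n)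
  have : Mono f := mono_of_mono_f f this
  let T : ShortComplex (ChainComplex (ModuleCat.{v} S) ℕ) :=
    ShortComplex.mk f (Limits.cokernel.π f) (Limits.cokernel.condition f)
  have hT : T.ShortExact :=
    { exact := ShortComplex.exact_of_g_is_cokernel _ (Limits.cokernelIsCokernel f)
      mono_f := inferInstanceAs (Mono f)
      epi_g := inferInstanceAs (Epi (Limits.cokernel.π f)) }
  refine quasiIso_of_acyclic_cokernel hT fun n => ?_
  have hTn : ∀ m, (T.map (eval (ModuleCat.{v} S) (ComplexShape.down ℕ) m)).ShortExact := fun m =>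
    hT.map_of_exact _
  have hsurj : ∀ m, Function.Surjective (T.g.f m) := fun m =>
    (ModuleCat.epi_iff_surjective _).1 (hTn m).epi_g
  have hexact : ∀ m (x : L.X m), T.g.f m x = 0 → x ∈ Set.range (f.f m) := fun m x hx =>
    (ShortComplex.moduleCat_exact_iff _).1 (hTn m).exact x hx
  rw [exactAt_iff' _ (n + 1) n ((ComplexShape.down ℕ).next n) (by simp) rfl,
    ShortComplex.moduleCat_exact_iff]
  intro x hx
  obtain ⟨z, rfl⟩ := hsurj n x
  obtain ⟨w, k, hk⟩ := h n z fun m => by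
    by_cases hm : (ComplexShape.down ℕ).Rel n m
    · refine hexact m _ ?_
      have e := congrArg (fun g => g z) (congrArg ModuleCat.Hom.hom (T.g.comm n m))
      obtain rfl := (ComplexShape.down ℕ).next_eq' hm
      exact e.symm.trans hx
    · exact ⟨0, by rw [L.shape n m hm]; simp⟩
  refine ⟨T.g.f (n + 1) w, ?_⟩
  have e := congrArg (fun g => g w) (congrArg ModuleCat.Hom.hom (T.g.comm (n + 1) n))
  refine e.trans ?_
  change T.g.f n (L.d (n + 1) n w) = T.g.f n z
  have e' : T.g.f n (z - L.d (n + 1) n w) = 0 := by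
    rw [← hk]
    exact congrArg (fun g => g k) (congrArg (fun g => ModuleCat.Hom.hom (g.f n)) T.zero)
  rw [map_sub, sub_eq_zero] at e'
  exact e'.symm

end QuasiIsoLemmas

/-! ### Homology equivalences of spaces and of pairs -/

section PairSequence

variable (R : Type u) [Ring R]

/-- The coefficient module of singular homology. -/
abbrev coeff : ModuleCat.{max u v} R := ModuleCat.of R (ULift.{v} R)

/-- The sequence `C(A) ⟶ C(X) ⟶ C(X, A)` of a pair of spaces. -/
abbrev pairSequence (P : TopPair.{v}) : ShortComplex (ChainComplex (ModuleCat.{max u v} R) ℕ) :=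
  ShortComplex.mk (X₃ := (relativeChains.{u, v} R).obj P) (singularMap (coeff.{u, v} R) P.map)
    (Limits.cokernel.π (singularMap (coeff.{u, v} R) P.map)) (Limits.cokernel.condition _)

/-- The map of sequences induced by a map of pairs. -/
def pairSequenceMap {P Q : TopPair.{v}} (φ : P ⟶ Q) :
    pairSequence.{u, v} R P ⟶ pairSequence R Q where
  τ₁ := singularMap (coeff.{u, v} R) (TopPair.Hom.snd φ)
  τ₂ := singularMap (coeff.{u, v} R) (TopPair.Hom.fst φ)
  τ₃ := (relativeChains.{u, v} R).map φ
  comm₁₂ := by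
    simp only [← Functor.map_comp]
    exact congrArg _ (TopPair.Hom.w φ)
  comm₂₃ := (Limits.cokernel.π_desc _ _ _).symm

lemma pairSequence_shortExact (P : TopPair.{v}) : (pairSequence.{u, v} R P).ShortExact where
  exact := ShortComplex.exact_of_g_is_cokernel _ (Limits.cokernelIsCokernel _)
  mono_f := by
    have : Mono P.map := (TopCat.mono_iff_injective _).2 P.isEmbedding_map.injective
    have : Limits.HasPullbacks (ModuleCat.{max u v} R) := Abelian.hasPullbacks
    exact Functor.map_mono
      ((AlgebraicTopology.singularChainComplexFunctor _).obj (coeff.{u, v} R)) P.map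
  epi_g := inferInstanceAs (Epi (Limits.cokernel.π _))

/-- A continuous map is a homology equivalence if it induces isomorphisms in singular homology. -/
def HEquiv {X Y : TopCat.{v}} (f : X ⟶ Y) : Prop :=
  QuasiIso (singularMap (coeff.{u, v} R) f)

/-- A map of pairs is a homology equivalence if it induces isomorphisms in relative homology. -/
def PairHEquiv {P Q : TopPair.{v}} (φ : P ⟶ Q) : Prop :=
  QuasiIso ((relativeChains.{u, v} R).map φ)

variable {R}

lemma PairHEquiv.of_components {P Q : TopPair.{v}} {φ : P ⟶ Q}
    (h₁ : HEquiv R (TopPair.Hom.fst φ)) (h₂ : HEquiv R (TopPair.Hom.snd φ)) : PairHEquiv R φ :=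
  HomologicalComplex.HomologySequence.quasiIso_τ₃ (pairSequenceMap R φ)
    (pairSequence_shortExact R P) (pairSequence_shortExact R Q) h₂ h₁

/-- If a map of pairs and its restriction to the subspaces are homology equivalences, so is the map
of the ambient spaces. -/
lemma PairHEquiv.fst {P Q : TopPair.{v}} {φ : P ⟶ Q} (h : PairHEquiv R φ)
    (h₂ : HEquiv R (TopPair.Hom.snd φ)) : HEquiv R (TopPair.Hom.fst φ) :=
  quasiIso_middle (pairSequenceMap R φ) (pairSequence_shortExact R P)
    (pairSequence_shortExact R Q) h₂ h

lemma PairHEquiv.isIso {P Q : TopPair.{v}} {φ : P ⟶ Q} (h : PairHEquiv R φ) :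
    IsIso ((relativeHomology.{u, v} R).map φ) := by
  have : QuasiIso ((relativeChains.{u, v} R).map φ) := h
  refine @GradedObject.isIso_of_isIso_apply _ _ _ _ _ _ fun i => ?_
  exact inferInstanceAs (IsIso (HomologicalComplex.homologyMap ((relativeChains.{u, v} R).map φ) i))

lemma isAcyclic_iff {Y : Type v} [TopologicalSpace Y] (A : Set Y) :
    IsAcyclic R A ↔ HEquiv R (TopCat.ofHom (ContinuousMap.const A PUnit.unit) :
      TopCat.of A ⟶ TopCat.of PUnit.{v + 1}) := by
  rw [HEquiv, quasiIso_iff]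
  exact forall_congr' fun n => (quasiIsoAt_iff_isIso_homologyMap _ n).symm

section TwoOfThree

variable {X Y Z : TopCat.{v}} {f : X ⟶ Y} {g : Y ⟶ Z}

lemma HEquiv.comp (hf : HEquiv R f) (hg : HEquiv R g) : HEquiv R (f ≫ g) := by
  rw [HEquiv] at *
  rw [singularMap, Functor.map_comp]
  infer_instance

lemma HEquiv.of_comp_right (hg : HEquiv R g) (hfg : HEquiv R (f ≫ g)) : HEquiv R f := by
  rw [HEquiv] at *
  rw [singularMap, Functor.map_comp] at hfg
  exact quasiIso_of_comp_right _ (singularMap (coeff R) g)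

lemma HEquiv.of_comp_left (hf : HEquiv R f) (hfg : HEquiv R (f ≫ g)) : HEquiv R g := by
  rw [HEquiv] at *
  rw [singularMap, Functor.map_comp] at hfg
  exact quasiIso_of_comp_left (singularMap (coeff R) f) _

variable {P Q T : TopPair.{v}} {φ : P ⟶ Q} {ψ : Q ⟶ T}

lemma PairHEquiv.comp (hφ : PairHEquiv R φ) (hψ : PairHEquiv R ψ) : PairHEquiv R (φ ≫ ψ) := by
  rw [PairHEquiv] at *
  rw [Functor.map_comp]
  infer_instance

lemma PairHEquiv.of_comp_left (hφ : PairHEquiv R φ) (h : PairHEquiv R (φ ≫ ψ)) :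
    PairHEquiv R ψ := by
  rw [PairHEquiv] at *
  rw [Functor.map_comp] at h
  exact quasiIso_of_comp_left ((relativeChains R).map φ) _

end TwoOfThree

end PairSequence

/-! ### Small simplices -/

section SmallSimplices

variable {R : Type u} [Ring R] {X A B : TopCat.{v}} (i : A ⟶ X) (j : B ⟶ X)

/-- The singular `n`-chains of `X` that are sums of chains of `A` and chains of `B`. -/
def sumChains (R : Type u) [Ring R] (n : ℕ) :
    Submodule R ((singularChains (coeff.{u, v} R) X).X n) :=
  LinearMap.range ((singularMap (coeff.{u, v} R) i).f n).hom ⊔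
    LinearMap.range ((singularMap (coeff.{u, v} R) j).f n).hom

lemma exists_comp_eq_of_range_subset {i : A ⟶ X} (hi : Topology.IsEmbedding i) {T : Type*}
    [TopologicalSpace T] (σ : C(T, X)) (h : Set.range σ ⊆ Set.range i) :
    ∃ τ : C(T, A), i.hom.comp τ = σ := by
  choose τ hτ using fun t => h ⟨t, rfl⟩
  have hc : i ∘ τ = σ := funext hτ
  refine ⟨⟨τ, hi.continuous_iff.2 ?_⟩, ContinuousMap.ext hτ⟩
  rw [hc]
  exact σ.continuous

variable {i j}

lemma simplexι_mem_sumChains (hi : Topology.IsEmbedding i) (hj : Topology.IsEmbedding j) {n : ℕ}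
    (σ : C(stdSimplex ℝ (Fin (n + 1)), X))
    (h : Set.range σ ⊆ Set.range i ∨ Set.range σ ⊆ Set.range j) (a : coeff.{u, v} R) :
    (simplexι (coeff.{u, v} R) σ).hom a ∈ sumChains i j R n := by
  rcases h with h | h
  · obtain ⟨τ, rfl⟩ := exists_comp_eq_of_range_subset hi σ h
    rw [← simplexι_map]
    exact Submodule.mem_sup_left ⟨_, rfl⟩
  · obtain ⟨τ, rfl⟩ := exists_comp_eq_of_range_subset hj σ h
    rw [← simplexι_map]
    exact Submodule.mem_sup_right ⟨_, rfl⟩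

/-- The singular simplices generate the singular chains. -/
lemma singularChains_induction {n : ℕ} (N : Submodule R ((singularChains (coeff.{u, v} R) X).X n))
    (h : ∀ (σ : C(stdSimplex ℝ (Fin (n + 1)), X)) (a : coeff.{u, v} R),
      (simplexι (coeff.{u, v} R) σ).hom a ∈ N)
    (c : (singularChains (coeff.{u, v} R) X).X n) : c ∈ N := by
  have h₀ : ModuleCat.ofHom N.mkQ = 0 := singularChains_hom_ext fun σ => by
    ext a
    exact (Submodule.Quotient.mk_eq_zero N).2 (h σ a)
  exact (Submodule.Quotient.mk_eq_zero N).1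
    (congrArg (fun g => ModuleCat.Hom.hom g c) h₀)

/-- Natural operations on singular chains preserve the sums of chains of `A` and `B`. -/
lemma map_mem_sumChains {n m : ℕ} (t : ∀ Y : TopCat.{v}, (singularChains (coeff.{u, v} R) Y).X n ⟶
      (singularChains (coeff.{u, v} R) Y).X m)
    (ht : ∀ {Y Z : TopCat.{v}} (f : Y ⟶ Z), (singularMap (coeff.{u, v} R) f).f n ≫ t Z =
      t Y ≫ (singularMap (coeff.{u, v} R) f).f m)
    {c : (singularChains (coeff.{u, v} R) X).X n} (hc : c ∈ sumChains i j R n) :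
    (t X).hom c ∈ sumChains i j R m := by
  obtain ⟨_, ⟨a, rfl⟩, _, ⟨b, rfl⟩, rfl⟩ := Submodule.mem_sup.1 hc
  rw [map_add]
  exact add_mem
    (Submodule.mem_sup_left ⟨(t A).hom a, (congrArg (fun g => ModuleCat.Hom.hom g a) (ht i)).symm⟩)
    (Submodule.mem_sup_right ⟨(t B).hom b, (congrArg (fun g => ModuleCat.Hom.hom g b) (ht j)).symm⟩)

lemma singularSd_iterate_realize {n k : ℕ} (σ : C(stdSimplex ℝ (Fin (n + 1)), X))
    (c : VertexChain (k + 1) (stdSimplex ℝ (Fin (n + 1)))) (a : coeff.{u, v} R) (r : ℕ) :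
    (singularSd (coeff.{u, v} R) X k).hom^[r] ((realize (coeff.{u, v} R) σ k c).hom a) =
      (realize (coeff.{u, v} R) σ k ((vertexSd (barycenterOf n) (k + 1))^[r] c)).hom a := by
  induction r with
  | zero => rfl
  | succ r ih =>
    rw [Function.iterate_succ_apply', Function.iterate_succ_apply', ih, ← realize_sd]
    rfl

/-- Let every `ε`-ball in the domain of a singular simplex `σ` be mapped to `A` or to `B`. Then `σ`
composed with affine simplices of size `ε` gives sums of chains of `A` and of `B`. -/
lemma realize_mem_sumChains (hi : Topology.IsEmbedding i) (hj : Topology.IsEmbedding j) {n k : ℕ}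
    (σ : C(stdSimplex ℝ (Fin (n + 1)), X)) {ε : ℝ} (hε : 0 ≤ ε)
    (h : ∀ t, σ '' Metric.closedBall t ε ⊆ Set.range i ∨ σ '' Metric.closedBall t ε ⊆ Set.range j)
    {c : VertexChain (k + 1) (stdSimplex ℝ (Fin (n + 1)))} (hc : c ∈ smallChains (n + 1) (k + 1) ε)
    (a : coeff.{u, v} R) : (realize (coeff.{u, v} R) σ k c).hom a ∈ sumChains i j R k := by
  rw [realize, Finsupp.linearCombination_apply, Finsupp.sum, ModuleCat.hom_sum,
    LinearMap.sum_apply]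
  refine Submodule.sum_mem _ fun w hw => ?_
  rw [ModuleCat.hom_zsmul, LinearMap.smul_apply]
  refine zsmul_mem (simplexι_mem_sumChains hi hj _ ?_ a) _
  have hr : Set.range (σ.comp (affineSimplex w)) ⊆ σ '' Metric.closedBall (w 0) ε := by
    rintro _ ⟨t, rfl⟩
    refine ⟨affineSimplex w t, ?_, rfl⟩
    rw [Metric.mem_closedBall, dist_comm]
    exact dist_affineSimplex_le hε (fun l => hc hw 0 l) t
  exact (h (w 0)).imp hr.trans hr.trans

/-- Every singular chain becomes a sum of chains of the members of an open cover after sufficiently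
many subdivisions. -/
lemma exists_singularSd_iterate_mem_sumChains (hi : Topology.IsOpenEmbedding i)
    (hj : Topology.IsOpenEmbedding j) (hcov : Set.range i ∪ Set.range j = Set.univ) {n : ℕ}
    (c : (singularChains (coeff.{u, v} R) X).X n) :
    ∃ r₀, ∀ r ≥ r₀, (singularSd (coeff.{u, v} R) X n).hom^[r] c ∈ sumChains i j R n := by
  -- the property holds for all large `r` and not just for one, so that it is closed under addition
  let N : Submodule R ((singularChains (coeff.{u, v} R) X).X n) :=
    { carrier := {c | ∃ r₀, ∀ r ≥ r₀,
        (singularSd (coeff.{u, v} R) X n).hom^[r] c ∈ sumChains i j R n}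
      zero_mem' := ⟨0, fun r _ => by
        rw [Function.iterate_fixed (map_zero _)]
        exact zero_mem _⟩
      add_mem' := by
        rintro a b ⟨r₁, h₁⟩ ⟨r₂, h₂⟩
        refine ⟨max r₁ r₂, fun r hr => ?_⟩
        rw [iterate_map_add]
        exact add_mem (h₁ r ((le_max_left _ _).trans hr)) (h₂ r ((le_max_right _ _).trans hr))
      smul_mem' := by
        rintro s a ⟨r₁, h₁⟩
        refine ⟨r₁, fun r hr => ?_⟩
        rw [← Module.End.pow_apply, map_smul, Module.End.pow_apply]
        exact Submodule.smul_mem _ _ (h₁ r hr) }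
  refine singularChains_induction N (fun σ a => ?_) c
  obtain ⟨δ, hδ, h⟩ := lebesgue_number_lemma_of_metric (isCompact_univ (X := stdSimplex ℝ _))
    (c := fun b : Bool => cond b (σ ⁻¹' Set.range i) (σ ⁻¹' Set.range j))
    (by
      rintro (_ | _)
      · exact hj.isOpen_range.preimage σ.continuous
      · exact hi.isOpen_range.preimage σ.continuous)
    (by
      intro t _
      have : σ t ∈ Set.range i ∪ Set.range j := hcov ▸ Set.mem_univ _
      rcases this with h | h
      · exact Set.mem_iUnion.2 ⟨true, h⟩
      · exact Set.mem_iUnion.2 ⟨false, h⟩)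
  obtain ⟨r₀, hr₀⟩ := exists_vertexSd_iterate_mem_smallChains n (half_pos hδ)
    (stdSimplex.vertex : Fin (n + 1) → stdSimplex ℝ (Fin (n + 1)))
  refine ⟨r₀, fun r hr => ?_⟩
  rw [← realize_vertex σ, singularSd_iterate_realize]
  refine realize_mem_sumChains hi.isEmbedding hj.isEmbedding σ (half_pos hδ).le (fun t => ?_)
    (hr₀ r hr) a
  have hb : Metric.closedBall t (δ / 2) ⊆ Metric.ball t δ :=
    Metric.closedBall_subset_ball (half_lt_self hδ)
  obtain ⟨_ | _, ht⟩ := h t (Set.mem_univ t)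
  · exact Or.inr (Set.image_subset_iff.2 (hb.trans ht))
  · exact Or.inl (Set.image_subset_iff.2 (hb.trans ht))

/-- A chain differs from its subdivision by a boundary, up to the homotopy applied to its own
boundary. -/
lemma exists_sub_singularSd_sub_d_mem {n : ℕ} (c : (singularChains (coeff.{u, v} R) X).X n)
    (hc : ∀ m, (singularChains (coeff.{u, v} R) X).d n m c ∈ sumChains i j R m) :
    ∃ w, c - (singularSd (coeff.{u, v} R) X n).hom c -
      (singularChains (coeff.{u, v} R) X).d (n + 1) n w ∈ sumChains i j R n := by
  refine ⟨(singularHtpy (coeff.{u, v} R) X n).hom c, ?_⟩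
  cases n with
  | zero =>
    have h := congrArg (fun g => ModuleCat.Hom.hom g c) (singularHtpy_d_zero (coeff.{u, v} R) X)
    have h' : (singularChains (coeff.{u, v} R) X).d 1 0
        ((singularHtpy (coeff.{u, v} R) X 0).hom c) =
        c - (singularSd (coeff.{u, v} R) X 0).hom c := h
    rw [h', sub_self]
    exact zero_mem _
  | succ n =>
    have h := congrArg (fun g => ModuleCat.Hom.hom g c) (singularHtpy_d_succ (coeff.{u, v} R) X n)
    have h' : (singularChains (coeff.{u, v} R) X).d (n + 2) (n + 1)
        ((singularHtpy (coeff.{u, v} R) X (n + 1)).hom c) =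
        c - (singularSd (coeff.{u, v} R) X (n + 1)).hom c -
          (singularHtpy (coeff.{u, v} R) X n).hom
            ((singularChains (coeff.{u, v} R) X).d (n + 1) n c) := h
    rw [h', sub_sub_cancel]
    exact map_mem_sumChains (fun Y => singularHtpy (coeff.{u, v} R) Y n)
      (fun f => singularMap_htpy _ _ f) (hc n)

/-- Relative to an open cover, a chain with small boundary is small up to a boundary. -/
lemma exists_sub_d_mem_sumChains (hi : Topology.IsOpenEmbedding i)
    (hj : Topology.IsOpenEmbedding j) (hcov : Set.range i ∪ Set.range j = Set.univ) {n : ℕ}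
    (c : (singularChains (coeff.{u, v} R) X).X n)
    (hc : ∀ m, (singularChains (coeff.{u, v} R) X).d n m c ∈ sumChains i j R m) :
    ∃ w, c - (singularChains (coeff.{u, v} R) X).d (n + 1) n w ∈ sumChains i j R n := by
  have hd : ∀ c : (singularChains (coeff.{u, v} R) X).X n,
      (∀ m, (singularChains (coeff.{u, v} R) X).d n m c ∈ sumChains i j R m) →
      ∀ m, (singularChains (coeff.{u, v} R) X).d n m
        ((singularSd (coeff.{u, v} R) X n).hom c) ∈ sumChains i j R m := by
    intro c hc m
    by_cases hnm : (ComplexShape.down ℕ).Rel n m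
    · obtain rfl : m + 1 = n := hnm
      have h := congrArg (fun g => ModuleCat.Hom.hom g c) (singularSd_d (coeff.{u, v} R) X m)
      have h' : (singularChains (coeff.{u, v} R) X).d (m + 1) m
          ((singularSd (coeff.{u, v} R) X (m + 1)).hom c) = (singularSd (coeff.{u, v} R) X m).hom
            ((singularChains (coeff.{u, v} R) X).d (m + 1) m c) := h
      rw [h']
      exact map_mem_sumChains (fun Y => singularSd (coeff.{u, v} R) Y m)
        (fun f => singularMap_sd _ _ f) (hc m)
    · rw [(singularChains (coeff.{u, v} R) X).shape n m hnm]
      exact zero_mem _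
  have key : ∀ r, (∀ m, (singularChains (coeff.{u, v} R) X).d n m
      ((singularSd (coeff.{u, v} R) X n).hom^[r] c) ∈ sumChains i j R m) ∧
      ∃ w, c - (singularSd (coeff.{u, v} R) X n).hom^[r] c -
        (singularChains (coeff.{u, v} R) X).d (n + 1) n w ∈ sumChains i j R n := by
    intro r
    induction r with
    | zero => exact ⟨hc, 0, by simp⟩
    | succ r ih =>
      rw [Function.iterate_succ_apply']
      refine ⟨hd _ ih.1, ?_⟩
      obtain ⟨w, hw⟩ := ih.2
      obtain ⟨w', hw'⟩ := exists_sub_singularSd_sub_d_mem _ ih.1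
      refine ⟨w + w', ?_⟩
      have := add_mem hw hw'
      rw [map_add]
      convert this using 1
      abel
  obtain ⟨r, hr⟩ := exists_singularSd_iterate_mem_sumChains hi hj hcov c
  obtain ⟨w, hw⟩ := (key r).2
  refine ⟨w, ?_⟩
  have := add_mem hw (hr r le_rfl)
  convert this using 1
  abel

end SmallSimplices

/-! ### Excision for open sets -/

section OpenExcision

variable {R : Type u} [Ring R]

lemma relativeChains_π_surjective (P : TopPair.{v}) (n : ℕ) :
    Function.Surjective ((pairSequence.{u, v} R P).g.f n) :=
  (ModuleCat.epi_iff_surjective _).1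
    ((pairSequence_shortExact R P).map_of_exact (HomologicalComplex.eval _ _ n)).epi_g

lemma relativeChains_π_eq_zero_iff (P : TopPair.{v}) (n : ℕ)
    (x : (singularChains (coeff.{u, v} R) P.fst).X n) :
    (pairSequence.{u, v} R P).g.f n x = 0 ↔
      x ∈ Set.range ((singularMap (coeff.{u, v} R) P.map).f n) := by
  refine ⟨fun h => (ShortComplex.moduleCat_exact_iff _).1
    ((pairSequence_shortExact R P).map_of_exact (HomologicalComplex.eval _ _ n)).exact x h, ?_⟩
  rintro ⟨y, rfl⟩
  exact congrArg (fun g => g y) (congrArg (fun g => ModuleCat.Hom.hom (g.f n))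
    (pairSequence.{u, v} R P).zero)

lemma relativeChains_map_π {P Q : TopPair.{v}} (φ : P ⟶ Q) (n : ℕ)
    (x : (singularChains (coeff.{u, v} R) P.fst).X n) :
    ((relativeChains.{u, v} R).map φ).f n ((pairSequence.{u, v} R P).g.f n x) =
      (pairSequence.{u, v} R Q).g.f n
        ((singularMap (coeff.{u, v} R) (TopPair.Hom.fst φ)).f n x) :=
  congrArg (fun g => g x) (congrArg (fun g => ModuleCat.Hom.hom (g.f n))
    (pairSequenceMap R φ).comm₂₃.symm)

open scoped Classical in
/-- If `P.fst` meets `Q.snd` in `P.snd`, then `C(P.fst)` meets `C(Q.snd)` in `C(P.snd)`. -/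
lemma mem_range_of_map_mem_range {P Q : TopPair.{v}} (φ : P ⟶ Q)
    (hφ : Topology.IsEmbedding (TopPair.Hom.fst φ))
    (hinter : Set.range (TopPair.Hom.fst φ) ∩ Set.range Q.map ⊆
      Set.range (P.map ≫ TopPair.Hom.fst φ)) (n : ℕ)
    (a : (singularChains (coeff.{u, v} R) P.fst).X n)
    (h : (singularMap (coeff.{u, v} R) (TopPair.Hom.fst φ)).f n a ∈
      Set.range ((singularMap (coeff.{u, v} R) Q.map).f n)) :
    a ∈ Set.range ((singularMap (coeff.{u, v} R) P.map).f n) := by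
  have hP : Topology.IsEmbedding (P.map ≫ TopPair.Hom.fst φ) := hφ.comp P.isEmbedding_map
  -- the projections of the chains of `Q` that discard the simplices outside of `P`
  let p : (singularChains (coeff.{u, v} R) Q.fst).X n ⟶
      (singularChains (coeff.{u, v} R) P.fst).X n :=
    singularDesc _ fun σ =>
      if h : ∃ τ : C(_, P.fst), (TopPair.Hom.fst φ).hom.comp τ = σ then
        simplexι _ h.choose else 0
  let q : (singularChains (coeff.{u, v} R) Q.snd).X n ⟶
      (singularChains (coeff.{u, v} R) P.snd).X n :=
    singularDesc _ fun σ =>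
      if h : ∃ τ : C(_, P.snd), (P.map ≫ TopPair.Hom.fst φ).hom.comp τ = Q.map.hom.comp σ then
        simplexι _ h.choose else 0
  have hp : ∀ τ : C(stdSimplex ℝ (Fin (n + 1)), P.fst),
      simplexι (coeff.{u, v} R) ((TopPair.Hom.fst φ).hom.comp τ) ≫ p = simplexι _ τ := by
    intro τ
    have hτ : ∃ τ' : C(_, P.fst), (TopPair.Hom.fst φ).hom.comp τ' =
        (TopPair.Hom.fst φ).hom.comp τ := ⟨τ, rfl⟩
    rw [simplexι_desc, dif_pos hτ]
    congr 1
    ext t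
    exact hφ.injective (DFunLike.congr_fun hτ.choose_spec t)
  have h₁ : (singularMap (coeff.{u, v} R) (TopPair.Hom.fst φ)).f n ≫ p = 𝟙 _ := by
    refine singularChains_hom_ext fun τ => ?_
    rw [← Category.assoc, simplexι_map, hp, Category.comp_id]
  have h₂ : (singularMap (coeff.{u, v} R) Q.map).f n ≫ p =
      q ≫ (singularMap (coeff.{u, v} R) P.map).f n := by
    refine singularChains_hom_ext fun σ => ?_
    rw [← Category.assoc, simplexι_map, ← Category.assoc]
    by_cases hσ : Set.range (Q.map.hom.comp σ) ⊆ Set.range (TopPair.Hom.fst φ)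
    · have hσ' : ∃ τ : C(_, P.snd), (P.map ≫ TopPair.Hom.fst φ).hom.comp τ = Q.map.hom.comp σ := by
        refine exists_comp_eq_of_range_subset hP _ ?_
        rintro _ ⟨t, rfl⟩
        exact hinter ⟨hσ ⟨t, rfl⟩, ⟨σ t, rfl⟩⟩
      have hq : simplexι (coeff.{u, v} R) σ ≫ q = simplexι _ hσ'.choose := by
        rw [simplexι_desc, dif_pos hσ']
      rw [hq, simplexι_map, ← hp]
      congr 2
      exact hσ'.choose_spec.symm
    · rw [simplexι_desc, simplexι_desc, dif_neg, dif_neg, Limits.zero_comp]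
      · rintro ⟨τ, hτ⟩
        refine hσ ?_
        rw [← hτ]
        rintro _ ⟨t, rfl⟩
        exact ⟨P.map (τ t), rfl⟩
      · rintro ⟨τ, hτ⟩
        refine hσ ?_
        rw [← hτ]
        rintro _ ⟨t, rfl⟩
        exact ⟨τ t, rfl⟩
  obtain ⟨b, hb⟩ := h
  refine ⟨q b, ?_⟩
  have e₁ := congrArg (fun g => ModuleCat.Hom.hom g a) h₁
  have e₂ := congrArg (fun g => ModuleCat.Hom.hom g b) h₂
  refine e₂.symm.trans (Eq.trans ?_ e₁)
  exact congrArg p.hom hb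

/-- Excision for a cover of `Q.fst` by the open sets `P.fst` and `Q.snd` with intersection `P.snd`.
The image of the injective map `C(P) ⟶ C(Q)` consists of the classes of sums of chains of `P.fst`
and of `Q.snd`. -/
theorem PairHEquiv.of_isOpenEmbedding {P Q : TopPair.{v}} (φ : P ⟶ Q)
    (hφ : Topology.IsOpenEmbedding (TopPair.Hom.fst φ)) (hQ : Topology.IsOpenEmbedding Q.map)
    (hcov : Set.range (TopPair.Hom.fst φ) ∪ Set.range Q.map = Set.univ)
    (hinter : Set.range (TopPair.Hom.fst φ) ∩ Set.range Q.map ⊆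
      Set.range (P.map ≫ TopPair.Hom.fst φ)) : PairHEquiv R φ := by
  have hmem : ∀ n (c : (singularChains (coeff.{u, v} R) Q.fst).X n),
      (pairSequence.{u, v} R Q).g.f n c ∈ Set.range (((relativeChains.{u, v} R).map φ).f n) ↔
        c ∈ sumChains (TopPair.Hom.fst φ) Q.map R n := by
    intro n c
    constructor
    · rintro ⟨x, hx⟩
      obtain ⟨a, rfl⟩ := relativeChains_π_surjective P n x
      rw [relativeChains_map_π, eq_comm, ← sub_eq_zero, ← map_sub,
        relativeChains_π_eq_zero_iff] at hx
      obtain ⟨b, hb⟩ := hx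
      have e := sub_eq_iff_eq_add'.1 hb.symm
      rw [e]
      exact add_mem (Submodule.mem_sup_left ⟨a, rfl⟩) (Submodule.mem_sup_right ⟨b, rfl⟩)
    · intro hc
      obtain ⟨_, ⟨a, rfl⟩, _, ⟨b, rfl⟩, rfl⟩ := Submodule.mem_sup.1 hc
      refine ⟨(pairSequence.{u, v} R P).g.f n a, ?_⟩
      rw [relativeChains_map_π, map_add]
      have : (pairSequence.{u, v} R Q).g.f n
          (((singularMap (coeff.{u, v} R) Q.map).f n).hom b) = 0 :=
        (relativeChains_π_eq_zero_iff Q n _).2 ⟨b, rfl⟩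
      rw [this, add_zero]
  refine quasiIso_of_injective _ (fun n => ?_) fun n z hz => ?_
  · rw [injective_iff_map_eq_zero]
    intro x hx
    obtain ⟨a, rfl⟩ := relativeChains_π_surjective P n x
    rw [relativeChains_map_π, relativeChains_π_eq_zero_iff] at hx
    exact (relativeChains_π_eq_zero_iff P n a).2
      (mem_range_of_map_mem_range φ hφ.isEmbedding hinter n a hx)
  · have hd : ∀ m k (y : (singularChains (coeff.{u, v} R) Q.fst).X m),
        ((relativeChains.{u, v} R).obj Q).d m k ((pairSequence.{u, v} R Q).g.f m y) =
          (pairSequence.{u, v} R Q).g.f k ((singularChains (coeff.{u, v} R) Q.fst).d m k y) :=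
      fun m k y => congrArg (fun g => ModuleCat.Hom.hom g y) ((pairSequence.{u, v} R Q).g.comm m k)
    obtain ⟨c, rfl⟩ := relativeChains_π_surjective Q n z
    obtain ⟨w, hw⟩ := exists_sub_d_mem_sumChains hφ hQ hcov c fun m => by
      rw [← hmem, ← hd]
      exact hz m
    refine ⟨(pairSequence.{u, v} R Q).g.f (n + 1) w, ?_⟩
    rw [hd, ← map_sub]
    exact (hmem n _).2 hw

end OpenExcision

/-! ### Homotopies given by specialization -/

section Specialization

variable {R : Type u} [Ring R]

lemma homologyMap_eq_of_homotopic {X Y : TopCat.{v}} {f g : X ⟶ Y} (h : f.hom.Homotopic g.hom)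
    (n : ℕ) : HomologicalComplex.homologyMap (singularMap (coeff.{u, v} R) f) n =
      HomologicalComplex.homologyMap (singularMap (coeff.{u, v} R) g) n :=
  TopCat.Homotopy.congr_homologyMap_singularChainComplexFunctor h.some _ n

lemma HEquiv.of_homotopyInverse {X Y : TopCat.{v}} (f : X ⟶ Y) (g : Y ⟶ X)
    (hfg : (f ≫ g).hom.Homotopic (ContinuousMap.id X))
    (hgf : (g ≫ f).hom.Homotopic (ContinuousMap.id Y)) : HEquiv R f := by
  rw [HEquiv, quasiIso_iff]
  intro n
  rw [quasiIsoAt_iff_isIso_homologyMap]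
  refine ⟨HomologicalComplex.homologyMap (singularMap (coeff.{u, v} R) g) n, ?_, ?_⟩
  · rw [← HomologicalComplex.homologyMap_comp, singularMap, singularMap, ← Functor.map_comp]
    refine (homologyMap_eq_of_homotopic (g := 𝟙 X) hfg n).trans ?_
    simp
  · rw [← HomologicalComplex.homologyMap_comp, singularMap, singularMap, ← Functor.map_comp]
    refine (homologyMap_eq_of_homotopic (g := 𝟙 Y) hgf n).trans ?_
    simp

/-- Maps `f` and `g` with `g x` in the closure of `f x` for all `x` are homotopic: the homotopy
jumps from `f` to `g` at the last moment. -/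
lemma homotopic_of_specializes {X Y : Type*} [TopologicalSpace X] [TopologicalSpace Y]
    {f g : C(X, Y)} (h : ∀ x, f x ⤳ g x) : f.Homotopic g := by
  classical
  refine ⟨⟨⟨fun p => if p.1 = 1 then g p.2 else f p.2, ⟨fun U hU => ?_⟩⟩,
    fun x => by simp, fun x => by simp⟩⟩
  have : (fun p : unitInterval × X => if p.1 = 1 then g p.2 else f p.2) ⁻¹' U =
      (Set.univ ×ˢ (g ⁻¹' U)) ∪ ({1}ᶜ ×ˢ (f ⁻¹' U)) := by
    ext ⟨t, x⟩
    by_cases ht : t = 1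
    · simp [ht]
    · simp only [Set.mem_preimage, ht, if_false, Set.mem_union, Set.mem_prod, Set.mem_univ,
        true_and, Set.mem_compl_iff, Set.mem_singleton_iff, not_false_eq_true]
      exact ⟨Or.inr, fun h' => h'.elim (fun hg => (h x).mem_open hU hg) id⟩
  rw [this]
  exact (isOpen_univ.prod (hU.preimage g.continuous)).union
    (isOpen_compl_singleton.prod (hU.preimage f.continuous))

/-- The map from a space to a point. -/
abbrev toPoint (X : Type v) [TopologicalSpace X] : TopCat.of X ⟶ TopCat.of PUnit.{v + 1} :=
  TopCat.ofHom (ContinuousMap.const X PUnit.unit)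

lemma hEquiv_toPoint {X : Type v} [TopologicalSpace X] (x : X)
    (h : (ContinuousMap.const X x).Homotopic (ContinuousMap.id X)) : HEquiv R (toPoint X) :=
  HEquiv.of_homotopyInverse (toPoint X) (TopCat.ofHom (ContinuousMap.const PUnit x)) h
    (ContinuousMap.Homotopic.refl _)

lemma HEquiv.of_toPoint {X Y : Type v} [TopologicalSpace X] [TopologicalSpace Y] (f : C(X, Y))
    (hX : HEquiv R (toPoint X)) (hY : HEquiv R (toPoint Y)) : HEquiv R (TopCat.ofHom f) :=
  HEquiv.of_comp_right (g := toPoint Y) hY hX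

end Specialization

/-! ### Subsets, excisive pairs and the Mayer–Vietoris argument -/

section Excisive

variable {R : Type u} [Ring R] {X Y Z : Type v} [TopologicalSpace X] [TopologicalSpace Y]
  [TopologicalSpace Z]

/-- The restriction of a continuous map to subspaces. -/
abbrev restrictMap (f : C(X, Y)) (A : Set X) (B : Set Y) (h : Set.MapsTo f A B) :
    TopCat.of A ⟶ TopCat.of B :=
  TopCat.ofHom ⟨fun a => ⟨f a.1, h a.2⟩, by fun_prop⟩

lemma HEquiv.of_homeomorph {X Y : Type v} [TopologicalSpace X] [TopologicalSpace Y] (e : X ≃ₜ Y) :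
    HEquiv R (TopCat.ofHom (e : C(X, Y))) :=
  HEquiv.of_homotopyInverse _ (TopCat.ofHom (e.symm : C(Y, X)))
    (by
      have : (TopCat.ofHom (e : C(X, Y)) ≫ TopCat.ofHom (e.symm : C(Y, X))).hom =
        ContinuousMap.id X := by ext x; simp
      rw [this])
    (by
      have : (TopCat.ofHom (e.symm : C(Y, X)) ≫ TopCat.ofHom (e : C(X, Y))).hom =
        ContinuousMap.id Y := by ext x; simp
      rw [this])

/-- The identification of the second space of the pair given by `A.2 ⊆ A.1` with `A.2`. -/
def toPairSnd (A : Set X × Set X) : (toPair A).snd ⟶ TopCat.of A.2 :=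
  TopCat.ofHom (X := (Subtype.val ⁻¹' A.2 : Set A.1)) (Y := A.2)
    ⟨fun a => ⟨a.1.1, a.2⟩, by fun_prop⟩

lemma hEquiv_toPairSnd {A : Set X × Set X} (hA : A.2 ⊆ A.1) : HEquiv R (toPairSnd A) :=
  HEquiv.of_homeomorph
    { toFun := fun a : (Subtype.val ⁻¹' A.2 : Set A.1) => (⟨a.1.1, a.2⟩ : A.2)
      invFun := fun a => ⟨⟨a.1, hA a.2⟩, a.2⟩
      left_inv := fun _ => rfl
      right_inv := fun _ => rfl
      continuous_toFun := by fun_prop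
      continuous_invFun := by fun_prop }

lemma snd_pairMap_toPairSnd (f : C(X, Y)) {A : Set X × Set X} {B : Set Y × Set Y}
    (h₁ : Set.MapsTo f A.1 B.1) (h₂ : Set.MapsTo f A.2 B.2) :
    TopPair.Hom.snd (pairMap f A B h₁ h₂) ≫ toPairSnd B =
      toPairSnd A ≫ restrictMap f A.2 B.2 h₂ := rfl

lemma hEquiv_snd_pairMap_iff (f : C(X, Y)) {A : Set X × Set X} {B : Set Y × Set Y}
    (hA : A.2 ⊆ A.1) (hB : B.2 ⊆ B.1) (h₁ : Set.MapsTo f A.1 B.1) (h₂ : Set.MapsTo f A.2 B.2) :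
    HEquiv R (TopPair.Hom.snd (pairMap f A B h₁ h₂)) ↔ HEquiv R (restrictMap f A.2 B.2 h₂) := by
  have e := snd_pairMap_toPairSnd f h₁ h₂
  constructor
  · intro h
    refine (hEquiv_toPairSnd hA).of_comp_left ?_
    rw [← e]
    exact h.comp (hEquiv_toPairSnd hB)
  · intro h
    refine (hEquiv_toPairSnd hB).of_comp_right ?_
    rw [e]
    exact (hEquiv_toPairSnd hA).comp h

/-- The inclusion of a pair of subsets into another. -/
abbrev pairIncl (A B : Set X × Set X) (h₁ : A.1 ⊆ B.1) (h₂ : A.2 ⊆ B.2) : toPair A ⟶ toPair B :=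
  pairMap (ContinuousMap.id X) A B h₁ h₂

lemma pairIncl_comp_pairMap (f : C(X, Y)) {A A' : Set X × Set X} {B B' : Set Y × Set Y}
    (hA₁ : A.1 ⊆ A'.1) (hA₂ : A.2 ⊆ A'.2) (hB₁ : B.1 ⊆ B'.1) (hB₂ : B.2 ⊆ B'.2)
    (h₁ : Set.MapsTo f A.1 B.1) (h₂ : Set.MapsTo f A.2 B.2)
    (h₁' : Set.MapsTo f A'.1 B'.1) (h₂' : Set.MapsTo f A'.2 B'.2) :
    pairIncl A A' hA₁ hA₂ ≫ pairMap f A' B' h₁' h₂' =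
      pairMap f A B h₁ h₂ ≫ pairIncl B B' hB₁ hB₂ := rfl

lemma PairHEquiv.pairMap (f : C(X, Y)) {A : Set X × Set X} {B : Set Y × Set Y}
    (hA : A.2 ⊆ A.1) (hB : B.2 ⊆ B.1) (h₁ : Set.MapsTo f A.1 B.1) (h₂ : Set.MapsTo f A.2 B.2)
    (e₁ : HEquiv R (restrictMap f A.1 B.1 h₁)) (e₂ : HEquiv R (restrictMap f A.2 B.2 h₂)) :
    PairHEquiv R (pairMap f A B h₁ h₂) :=
  PairHEquiv.of_components e₁ ((hEquiv_snd_pairMap_iff f hA hB h₁ h₂).2 e₂)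

/-- Two subsets form an excisive couple for singular homology: the inclusion
`(A, A ∩ B) ⟶ (A ∪ B, B)` is a homology equivalence. -/
def Excisive (R : Type u) [Ring R] (A B : Set X) : Prop :=
  PairHEquiv R (pairIncl (A, A ∩ B) (A ∪ B, B) Set.subset_union_left Set.inter_subset_right)

lemma excisive_of_isOpen {A B : Set X} (hA : IsOpen A) (hB : IsOpen B) : Excisive R A B := by
  refine PairHEquiv.of_isOpenEmbedding _ ?_ ?_ ?_ ?_
  · exact Topology.IsOpenEmbedding.of_comp _ (hA.union hB).isOpenEmbedding_subtypeVal
      hA.isOpenEmbedding_subtypeVal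
  · exact (hB.preimage continuous_subtype_val).isOpenEmbedding_subtypeVal
  · refine Set.eq_univ_of_forall ?_
    rintro ⟨x, hx | hx⟩
    · exact Or.inl ⟨⟨x, hx⟩, rfl⟩
    · exact Or.inr ⟨⟨⟨x, Or.inr hx⟩, hx⟩, rfl⟩
  · rintro _ ⟨⟨⟨x, hx⟩, rfl⟩, ⟨⟨⟨y, hy⟩, hy'⟩, h⟩⟩
    obtain rfl : y = x := congrArg Subtype.val h
    exact ⟨⟨⟨y, hx⟩, ⟨hx, hy'⟩⟩, rfl⟩

/-- The restriction of `f` over `V` is a homology equivalence. -/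
def HEquivOver (R : Type u) [Ring R] (f : C(X, Y)) (V : Set Y) : Prop :=
  HEquiv R (restrictMap f (f ⁻¹' V) V (Set.mapsTo_preimage f V))

/-- The Mayer–Vietoris step: by the two excisions, the map of pairs over `(V ∪ W, W)` is a homology
equivalence because the one over `(V, V ∩ W)` is. -/
lemma HEquivOver.union {f : C(X, Y)} {V W : Set Y} (hVW : Excisive R V W)
    (hVW' : Excisive R (f ⁻¹' V) (f ⁻¹' W)) (hV : HEquivOver R f V) (hW : HEquivOver R f W)
    (hi : HEquivOver R f (V ∩ W)) : HEquivOver R f (V ∪ W) := by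
  have h₁ : PairHEquiv R (pairMap f (f ⁻¹' V, f ⁻¹' V ∩ f ⁻¹' W) (V, V ∩ W)
      (Set.mapsTo_preimage f V) (Set.mapsTo_preimage f (V ∩ W))) :=
    PairHEquiv.pairMap f Set.inter_subset_left Set.inter_subset_left _ _ hV hi
  have h₂ : PairHEquiv R (pairMap f (f ⁻¹' V ∪ f ⁻¹' W, f ⁻¹' W) (V ∪ W, W)
      (Set.mapsTo_preimage f (V ∪ W)) (Set.mapsTo_preimage f W)) :=
    PairHEquiv.of_comp_left hVW' ((congrArg (PairHEquiv R) (pairIncl_comp_pairMap f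
      (A := (f ⁻¹' V, f ⁻¹' V ∩ f ⁻¹' W)) (A' := (f ⁻¹' V ∪ f ⁻¹' W, f ⁻¹' W))
      (B := (V, V ∩ W)) (B' := (V ∪ W, W)) _ _ _ _ _ _ _ _)).mpr (h₁.comp hVW))
  exact h₂.fst ((hEquiv_snd_pairMap_iff f Set.subset_union_right Set.subset_union_right _ _).2 hW)

lemma hEquivOver_empty (f : C(X, Y)) : HEquivOver R f ∅ :=
  HEquiv.of_homotopyInverse _ (TopCat.ofHom ⟨fun a => a.2.elim, continuous_of_const
    fun a => a.2.elim⟩)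
    (homotopic_of_specializes fun a => a.2.elim) (homotopic_of_specializes fun a => a.2.elim)

/-- Let `𝒱` be a class of subsets of a finite space `Y` which is closed under intersections, with a
least member `b y` containing each point `y`, and in which every nonempty member has a point that
can be removed. If the members of `𝒱` and their preimages are excisive, then a map which is a
homology equivalence over all `b y` is a homology equivalence over all members of `𝒱`. -/
lemma hEquivOver_of_basis [Finite Y] (f : C(X, Y)) (𝒱 : Set Y → Prop) (b : Y → Set Y)
    (hinter : ∀ V W, 𝒱 V → 𝒱 W → 𝒱 (V ∩ W)) (hb : ∀ y, 𝒱 (b y)) (hmem : ∀ y, y ∈ b y)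
    (hmin : ∀ V, 𝒱 V → ∀ y ∈ V, b y ⊆ V) (herase : ∀ V, 𝒱 V → V.Nonempty → ∃ y ∈ V, 𝒱 (V \ {y}))
    (hexc : ∀ V W, 𝒱 V → 𝒱 W → Excisive R V W)
    (hexc' : ∀ V W, 𝒱 V → 𝒱 W → Excisive R (f ⁻¹' V) (f ⁻¹' W))
    (hf : ∀ y, HEquivOver R f (b y)) (V : Set Y) (hV : 𝒱 V) : HEquivOver R f V := by
  induction hn : V.ncard using Nat.strong_induction_on generalizing V with
  | _ n ih =>
    rcases V.eq_empty_or_nonempty with rfl | hne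
    · exact hEquivOver_empty f
    obtain ⟨y, hy, hVy⟩ := herase V hV hne
    have hlt : (V \ {y}).ncard < n := hn ▸ Set.ncard_sdiff_singleton_lt_of_mem hy
    have hunion : b y ∪ V \ {y} = V := by
      refine Set.Subset.antisymm (Set.union_subset (hmin V hV y hy) Set.sdiff_subset) fun x hx => ?_
      by_cases hxy : x = y
      · exact Or.inl (hxy ▸ hmem y)
      · exact Or.inr ⟨hx, hxy⟩
    rw [← hunion]
    refine HEquivOver.union (hexc _ _ (hb y) hVy) (hexc' _ _ (hb y) hVy) (hf y)
      (ih _ hlt _ hVy rfl) (ih _ ?_ _ (hinter _ _ (hb y) hVy) rfl)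
    exact (Set.ncard_le_ncard Set.inter_subset_right).trans_lt hlt

/-- The inclusion of a subspace. -/
def inclMap (S : Set X) : TopCat.of S ⟶ TopCat.of X :=
  TopCat.ofHom ⟨Subtype.val, continuous_subtype_val⟩

lemma restrictMap_comp_inclMap (f : C(X, Y)) (A : Set X) (B : Set Y) (h : Set.MapsTo f A B) :
    restrictMap f A B h ≫ inclMap B = inclMap A ≫ TopCat.ofHom f := rfl

lemma hEquiv_inclMap {S : Set X} (hS : S = Set.univ) : HEquiv R (inclMap S) := by
  subst hS
  exact HEquiv.of_homeomorph (Homeomorph.Set.univ X)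

lemma HEquiv.of_hEquivOver_univ {f : C(X, Y)} (h : HEquivOver R f Set.univ) :
    HEquiv R (TopCat.ofHom f) := by
  refine HEquiv.of_comp_left (f := inclMap (Set.univ : Set X)) (hEquiv_inclMap rfl) ?_
  rw [← restrictMap_comp_inclMap f Set.univ Set.univ (Set.mapsTo_univ _ _)]
  exact HEquiv.comp h (hEquiv_inclMap rfl)

/-- A map to a finite `T₀` space is a homology equivalence if it is one over the minimal open
neighbourhoods of the points (McCord's criterion). -/
theorem HEquiv.of_nhdsKer [Finite Y] [T0Space Y] (f : C(X, Y))
    (hf : ∀ y, HEquivOver R f (nhdsKer {y})) : HEquiv R (TopCat.ofHom f) := by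
  refine HEquiv.of_hEquivOver_univ (hEquivOver_of_basis f IsOpen (fun y => nhdsKer {y})
    (fun _ _ => IsOpen.inter) (fun y => isOpen_nhdsKer)
    (fun y => subset_nhdsKer rfl) (fun V hV y hy => ?_) (fun V hV hne => ?_)
    (fun _ _ => excisive_of_isOpen)
    (fun _ _ h h' => excisive_of_isOpen (h.preimage f.continuous) (h'.preimage f.continuous))
    hf _ isOpen_univ)
  · exact nhdsKer_minimal (Set.singleton_subset_iff.2 hy) hV
  · have := hne.to_subtype
    -- a nonempty finite `T₀` space has a closed point
    obtain ⟨y, -, hy⟩ := IsClosed.exists_closed_singleton (isClosed_univ (X := V)) Set.univ_nonempty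
    refine ⟨y.1, y.2, ?_⟩
    have h := hV.isOpenMap_subtype_val _ hy.isOpen_compl
    convert h using 1
    ext x
    simp only [Set.mem_sdiff, Set.mem_singleton_iff, Set.mem_image, Set.mem_compl_iff,
      Subtype.exists, exists_and_right, exists_eq_right, Subtype.ext_iff]
    tauto

end Excisive

/-! ### Excision for closed subsets of a finite space -/

section ClosedExcision

variable {R : Type u} [Ring R] {X Y : Type v} [TopologicalSpace X] [TopologicalSpace Y]

/-- The double mapping cylinder of two subsets, with truth values instead of an interval: the copy
of `A` at `(True, False)` and the copy of `B` at `(False, True)` are glued along the copy of `A ∩ B`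
at `(True, True)`. It is covered by two open sets that retract to `A` and `B`. -/
def doubleCylinder (A B : Set X) : Set (X × Prop × Prop) :=
  {z | (z.2.1 ∨ z.2.2) ∧ (z.2.1 → z.1 ∈ A) ∧ (z.2.2 → z.1 ∈ B)}

variable {A B : Set X}

lemma specializes_false (p : Prop) : p ⤳ False := by
  rw [Specializes, nhds_false]
  exact le_top

/-- In the Sierpiński space `Prop` the point `True` is open. -/
lemma specializes_of_imp {p q : Prop} (h : q → p) : p ⤳ q := by
  by_cases hq : q
  · rw [eq_true hq, eq_true (h hq)]
  · rw [eq_false hq]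
    exact specializes_false _

lemma hEquiv_toPoint_nhdsKer (y : Y) : HEquiv R (toPoint (nhdsKer {y} : Set Y)) :=
  hEquiv_toPoint ⟨y, subset_nhdsKer rfl⟩ (homotopic_of_specializes fun z =>
    Topology.IsInducing.subtypeVal.specializes_iff.1 (mem_nhdsKer_singleton.1 z.2)).symm

lemma hEquiv_toPoint_closure (y : Y) : HEquiv R (toPoint (closure {y} : Set Y)) :=
  hEquiv_toPoint ⟨y, subset_closure rfl⟩ (homotopic_of_specializes fun z =>
    Topology.IsInducing.subtypeVal.specializes_iff.1 (specializes_iff_mem_closure.2 z.2))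

/-- The projection of the double cylinder. -/
def cylinderProj (A B : Set X) : C(doubleCylinder A B, X) := ⟨fun z => z.1.1, by fun_prop⟩

/-- The projection of a part `W` of the double cylinder is a homology equivalence to `C` if it has
a section at a fixed level `(p, q)` in the closure of the levels that occur in `W`. -/
lemma hEquiv_cylinderProj {W : Set (doubleCylinder A B)} {C : Set X}
    (hW : Set.MapsTo (cylinderProj A B) W C) (p q : Prop)
    (hC : ∀ x ∈ C, ∃ h : (x, p, q) ∈ doubleCylinder A B, ⟨(x, p, q), h⟩ ∈ W)
    (hpq : ∀ z ∈ W, (p → z.1.2.1) ∧ (q → z.1.2.2)) :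
    HEquiv R (restrictMap (cylinderProj A B) W C hW) := by
  let s : C(C, W) := ⟨fun x => ⟨⟨(x.1, p, q), (hC x.1 x.2).choose⟩, (hC x.1 x.2).choose_spec⟩, by
    refine Continuous.subtype_mk (Continuous.subtype_mk ?_ _) _
    fun_prop⟩
  refine HEquiv.of_homotopyInverse _ (TopCat.ofHom s) ?_ (ContinuousMap.Homotopic.refl _)
  refine (homotopic_of_specializes fun z => ?_).symm
  refine Topology.IsInducing.subtypeVal.specializes_iff.1
    (Topology.IsInducing.subtypeVal.specializes_iff.1 ?_)
  exact specializes_rfl.prod ((specializes_of_imp (hpq z.1 z.2).1).prod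
    (specializes_of_imp (hpq z.1 z.2).2))

/-- The projection of the double cylinder to the union of the two subsets. -/
def cylinderProjUnion (A B : Set X) : C(doubleCylinder A B, (A ∪ B : Set X)) :=
  ⟨fun z => ⟨z.1.1, z.2.1.imp z.2.2.1 z.2.2.2⟩, by fun_prop⟩

lemma inclMap_comp_cylinderProjUnion {W : Set (doubleCylinder A B)}
    (hW : Set.MapsTo (cylinderProj A B) W (A ∪ B)) :
    restrictMap (cylinderProj A B) W (A ∪ B) hW =
      inclMap W ≫ TopCat.ofHom (cylinderProjUnion A B) := rfl

lemma hEquiv_cylinderProjUnion [Finite X] [T0Space X] (hA : IsClosed A) (hB : IsClosed B) :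
    HEquiv R (TopCat.ofHom (cylinderProjUnion A B)) := by
  refine HEquiv.of_nhdsKer _ fun y => ?_
  refine HEquiv.of_toPoint _ ?_ (hEquiv_toPoint_nhdsKer y)
  set W := cylinderProjUnion A B ⁻¹' nhdsKer {y}
  have hW : ∀ z : W, z.1.1.1 ⤳ y.1 := fun z =>
    Topology.IsInducing.subtypeVal.specializes_iff.2 (mem_nhdsKer_singleton.1 z.2)
  have hy : ∀ x : (A ∪ B : Set X), x.1 = y.1 → x ∈ nhdsKer {y} := by
    rintro x hx
    obtain rfl : x = y := Subtype.ext hx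
    exact subset_nhdsKer rfl
  -- the part over the minimal neighbourhood is pushed into the fibre over `y`, which has a
  -- generic point
  let c : W := ⟨⟨(y.1, y.1 ∈ A, y.1 ∈ B), y.2, id, id⟩, hy _ rfl⟩
  let r : C(W, W) := ⟨fun z => ⟨⟨(y.1, z.1.1.2.1, z.1.1.2.2), z.1.2.1,
    fun h => (hW z).mem_closed hA (z.1.2.2.1 h), fun h => (hW z).mem_closed hB (z.1.2.2.2 h)⟩,
    hy _ rfl⟩, by
    refine Continuous.subtype_mk (Continuous.subtype_mk ?_ _) _
    fun_prop⟩
  have h₁ : (ContinuousMap.const W c).Homotopic r := homotopic_of_specializes fun z => by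
    refine Topology.IsInducing.subtypeVal.specializes_iff.1
      (Topology.IsInducing.subtypeVal.specializes_iff.1 ?_)
    exact specializes_rfl.prod
      ((specializes_of_imp fun h => (hW z).mem_closed hA (z.1.2.2.1 h)).prod
        (specializes_of_imp fun h => (hW z).mem_closed hB (z.1.2.2.2 h)))
  have h₂ : (ContinuousMap.id W).Homotopic r := homotopic_of_specializes fun z => by
    refine Topology.IsInducing.subtypeVal.specializes_iff.1
      (Topology.IsInducing.subtypeVal.specializes_iff.1 ?_)
    exact (hW z).prod specializes_rfl
  exact hEquiv_toPoint c (h₁.trans h₂.symm)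

/-- Closed subsets of a finite `T₀` space are excisive, since they are the images of open subsets of
the double cylinder under homology equivalences. -/
theorem excisive_of_isClosed [Finite X] [T0Space X] (hA : IsClosed A) (hB : IsClosed B) :
    Excisive R A B := by
  let U : Set (doubleCylinder A B) := {z | z.1.2.1}
  let V : Set (doubleCylinder A B) := {z | z.1.2.2}
  have hU : IsOpen U := continuous_Prop.1 (by fun_prop)
  have hV : IsOpen V := continuous_Prop.1 (by fun_prop)
  have mU : Set.MapsTo (cylinderProj A B) U A := fun z hz => z.2.2.1 hz
  have mV : Set.MapsTo (cylinderProj A B) V B := fun z hz => z.2.2.2 hz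
  have mi : Set.MapsTo (cylinderProj A B) (U ∩ V) (A ∩ B) := fun z hz => ⟨mU hz.1, mV hz.2⟩
  have mu : Set.MapsTo (cylinderProj A B) (U ∪ V) (A ∪ B) := fun z hz => hz.imp (@mU z) (@mV z)
  have eU : HEquiv R (restrictMap (cylinderProj A B) U A mU) := hEquiv_cylinderProj mU True False
    (fun x hx => ⟨⟨Or.inl trivial, fun _ => hx, False.elim⟩, trivial⟩)
    fun z hz => ⟨fun _ => hz, False.elim⟩
  have eV : HEquiv R (restrictMap (cylinderProj A B) V B mV) := hEquiv_cylinderProj mV False True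
    (fun x hx => ⟨⟨Or.inr trivial, False.elim, fun _ => hx⟩, trivial⟩)
    fun z hz => ⟨False.elim, fun _ => hz⟩
  have ei : HEquiv R (restrictMap (cylinderProj A B) (U ∩ V) (A ∩ B) mi) :=
    hEquiv_cylinderProj mi True True
    (fun x hx => ⟨⟨Or.inl trivial, fun _ => hx.1, fun _ => hx.2⟩, trivial, trivial⟩)
    fun z hz => ⟨fun _ => hz.1, fun _ => hz.2⟩
  have eu : HEquiv R (restrictMap (cylinderProj A B) (U ∪ V) (A ∪ B) mu) := by
    rw [inclMap_comp_cylinderProjUnion]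
    exact HEquiv.comp (hEquiv_inclMap (Set.eq_univ_of_forall fun z => z.2.1))
      (hEquiv_cylinderProjUnion hA hB)
  have h₁ : PairHEquiv R (pairMap (cylinderProj A B) (U, U ∩ V) (A, A ∩ B) mU mi) :=
    PairHEquiv.pairMap (cylinderProj A B) Set.inter_subset_left Set.inter_subset_left _ _ eU ei
  have h₂ : PairHEquiv R (pairMap (cylinderProj A B) (U ∪ V, V) (A ∪ B, B) mu mV) :=
    PairHEquiv.pairMap (cylinderProj A B) Set.subset_union_right Set.subset_union_right _ _ eu eV
  have e := pairIncl_comp_pairMap (cylinderProj A B) (A := (U, U ∩ V)) (A' := (U ∪ V, V))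
    (B := (A, A ∩ B)) (B' := (A ∪ B, B)) Set.subset_union_left Set.inter_subset_right
    Set.subset_union_left Set.inter_subset_right mU mi mu mV
  refine PairHEquiv.of_comp_left h₁ ?_
  exact (congrArg (PairHEquiv R) e).mp (PairHEquiv.comp (excisive_of_isOpen hU hV) h₂)

/-! ### A Vietoris theorem for finite spaces -/

/-- A map of finite `T₀` spaces is a homology equivalence if it is one over the closures of the
points. -/
theorem HEquiv.of_closure [Finite X] [T0Space X] [Finite Y] [T0Space Y] (f : C(X, Y))
    (hf : ∀ y, HEquivOver R f (closure {y})) : HEquiv R (TopCat.ofHom f) := by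
  refine HEquiv.of_hEquivOver_univ (hEquivOver_of_basis f IsClosed (fun y => closure {y})
    (fun _ _ => IsClosed.inter) (fun y => isClosed_closure)
    (fun y => subset_closure rfl) (fun V hV y hy => ?_) (fun V hV hne => ?_)
    (fun _ _ => excisive_of_isClosed)
    (fun _ _ h h' => excisive_of_isClosed (h.preimage f.continuous) (h'.preimage f.continuous))
    hf _ isClosed_univ)
  · exact closure_minimal (Set.singleton_subset_iff.2 hy) hV
  · have := hne.to_subtype
    -- a nonempty finite `T₀` space has an open point
    obtain ⟨y, hy⟩ := exists_open_singleton_of_finite (X := V)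
    refine ⟨y.1, y.2, ?_⟩
    have h := hV.isClosedMap_subtype_val _ hy.isClosed_compl
    convert h using 1
    ext x
    simp only [Set.mem_sdiff, Set.mem_singleton_iff, Set.mem_image, Set.mem_compl_iff,
      Subtype.exists, exists_and_right, exists_eq_right, Subtype.ext_iff]
    tauto

/-- Vietoris theorem for finite spaces. Let `E` be the graph of a multivalued map `F` with acyclic
values that shrink under specialization. Then the projection of `E` to the domain is a homology
equivalence: the part of the graph over the closure of `z` retracts to `F z`. -/
theorem HEquiv.of_graph {E Z : Type v} [TopologicalSpace E] [TopologicalSpace Z] [Finite E]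
    [T0Space E] [Finite Z] [T0Space Z] (p : C(E, Z)) (q : C(E, Y)) (F : Z → Set Y)
    (hind : Topology.IsInducing fun e => (p e, q e)) (hq : ∀ e, q e ∈ F (p e))
    (hsurj : ∀ z, ∀ y ∈ F z, ∃ e, p e = z ∧ q e = y) (hF : ∀ z z', z ⤳ z' → F z' ⊆ F z)
    (hacyc : ∀ z, IsAcyclic R (F z)) : HEquiv R (TopCat.ofHom p) := by
  refine HEquiv.of_closure p fun z => HEquiv.of_toPoint _ ?_ (hEquiv_toPoint_closure z)
  have hz : ∀ e : p ⁻¹' closure {z}, z ⤳ p e.1 := fun e => specializes_iff_mem_closure.2 e.2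
  choose s hs₁ hs₂ using hsurj z
  let g : C(p ⁻¹' closure {z}, F z) := ⟨fun e => ⟨q e.1, hF _ _ (hz e) (hq e.1)⟩, by fun_prop⟩
  let t : C(F z, p ⁻¹' closure {z}) := ⟨fun y => ⟨s y.1 y.2, by
    rw [Set.mem_preimage, hs₁]
    exact subset_closure rfl⟩, by
    refine Continuous.subtype_mk (hind.continuous_iff.2 ?_) _
    simp only [Function.comp_def, hs₁, hs₂]
    fun_prop⟩
  have hg : HEquiv R (TopCat.ofHom g) := by
    refine HEquiv.of_homotopyInverse _ (TopCat.ofHom t) ?_ ?_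
    · refine homotopic_of_specializes fun e => ?_
      refine Topology.IsInducing.subtypeVal.specializes_iff.1 (hind.specializes_iff.1 ?_)
      change (p (s _ _), q (s _ _)) ⤳ (p e.1, q e.1)
      rw [hs₁, hs₂]
      exact (hz e).prod specializes_rfl
    · refine homotopic_of_specializes fun y => ?_
      refine Topology.IsInducing.subtypeVal.specializes_iff.1 ?_
      change q (s _ _) ⤳ y.1
      rw [hs₂]
  exact HEquiv.comp hg ((isAcyclic_iff (F z)).1 (hacyc z))

end ClosedExcision

/-! ### Induced maps of multivalued maps -/

section Induced

lemma image_mono {X Y : Type v} {F : X → Set Y} {A B : Set X} (h : A ⊆ B) :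
    image F A ⊆ image F B :=
  Set.biUnion_subset_biUnion_left h

lemma mem_image {X Y : Type v} {F : X → Set Y} {A : Set X} {y : Y} :
    y ∈ image F A ↔ ∃ x ∈ A, y ∈ F x := by
  simp [image]

variable {R : Type u} [Ring R] {X Y : Type v} [TopologicalSpace X] [TopologicalSpace Y]

lemma comp_inverse {E : Type*} [Category* E] [Limits.HasZeroMorphisms E] {A B : E} (f : A ⟶ B)
    [h : IsIso f] : f ≫ inverse f = 𝟙 A := by
  rw [inverse, dif_pos h, IsIso.hom_inv_id]

lemma inverse_comp {E : Type*} [Category* E] [Limits.HasZeroMorphisms E] {A B : E} (f : A ⟶ B)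
    [h : IsIso f] : inverse f ≫ f = 𝟙 B := by
  rw [inverse, dif_pos h, IsIso.inv_hom_id]

/-- Inverting the vertical maps of a commutative square. -/
lemma inverse_comp_eq_of_square {E : Type*} [Category* E] [Limits.HasZeroMorphisms E]
    {A B A' B' : E} {f : A ⟶ B} {f' : A' ⟶ B'} {g : A ⟶ A'} {h : B ⟶ B'} [IsIso f] [IsIso f']
    (e : f ≫ h = g ≫ f') : inverse f ≫ g = h ≫ inverse f' := by
  calc inverse f ≫ g = inverse f ≫ (g ≫ f') ≫ inverse f' := by
        rw [Category.assoc, comp_inverse, Category.comp_id]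
    _ = h ≫ inverse f' := by
        rw [← e, ← Category.assoc, ← Category.assoc, inverse_comp, Category.id_comp]

/-- Lower semicontinuity applied to the closed set `F x`. -/
lemma IsAdmissible.anti {F : X → Set Y} (hF : IsAdmissible R F) {x x' : X} (h : x ⤳ x') :
    F x' ⊆ F x :=
  h.mem_closed (hF.lsc _ (hF.closed x)) (Set.Subset.refl (F x))

/-- Excision for pairs of closed sets with the same difference: they have the form `(A, A ∩ B)` and
`(A ∪ B, B)`. -/
lemma excision_pairIncl [Finite X] [T0Space X] {P Q : Set X × Set X} (hP : IsClosed P.1)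
    (hQ : IsClosed Q.2) (hP' : P.2 ⊆ P.1) (hQ' : Q.2 ⊆ Q.1) (h₁ : P.1 ⊆ Q.1) (h₂ : P.2 ⊆ Q.2)
    (h : P.1 \ P.2 = Q.1 \ Q.2) : PairHEquiv R (pairIncl P Q h₁ h₂) := by
  obtain ⟨A, A'⟩ := P
  obtain ⟨B', B⟩ := Q
  dsimp only at *
  obtain rfl : A' = A ∩ B := by
    refine Set.Subset.antisymm (fun x hx => ⟨hP' hx, h₂ hx⟩) fun x hx => ?_
    by_contra hx'
    exact (h.subset ⟨hx.1, hx'⟩).2 hx.2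
  obtain rfl : B' = A ∪ B := by
    refine Set.Subset.antisymm (fun x hx => ?_) (Set.union_subset h₁ hQ')
    by_cases hx' : x ∈ B
    · exact Or.inr hx'
    · exact Or.inl (h.superset ⟨hx, hx'⟩).1
  exact excisive_of_isClosed hP hQ

lemma hEquiv_graph_fst [Finite X] [T0Space X] [Finite Y] [T0Space Y] {F : X → Set Y}
    (hF : IsAdmissible R F) {A : Set X} {B : Set Y} (hAB : image F A ⊆ B) :
    HEquiv R (restrictMap ContinuousMap.fst {z : X × Y | z.1 ∈ A ∧ z.2 ∈ B ∧ z.2 ∈ F z.1} A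
      fun _ hz => hz.1) := by
  let q : C({z : X × Y | z.1 ∈ A ∧ z.2 ∈ B ∧ z.2 ∈ F z.1}, Y) := ⟨fun z => z.1.2, by fun_prop⟩
  refine HEquiv.of_graph _ q (fun a : A => F a.1) ?_
    (fun e => e.2.2.2) (fun z y hy => ⟨⟨(z.1, y), z.2, hAB (mem_image.2 ⟨z.1, z.2, hy⟩), hy⟩,
      rfl, rfl⟩) (fun z z' h => hF.anti (Topology.IsInducing.subtypeVal.specializes_iff.2 h))
    (fun z => hF.acyclic z.1)
  refine Topology.IsInducing.of_comp (g := Prod.map (Subtype.val : A → X) (id : Y → Y))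
    (by fun_prop) (by fun_prop) ?_
  exact Topology.IsInducing.subtypeVal

/-- The projection of the graph of an admissible map of pairs to its domain is a homology
equivalence. -/
lemma pairHEquiv_graphFst [Finite X] [T0Space X] [Finite Y] [T0Space Y] {F : X → Set Y}
    (hF : IsAdmissible R F) {P : Set X × Set X} {Q : Set Y × Set Y} (hP : P.2 ⊆ P.1)
    (hQ : Q.2 ⊆ Q.1) (h₁ : image F P.1 ⊆ Q.1) (h₂ : image F P.2 ⊆ Q.2) :
    PairHEquiv R (graphFst F P Q) :=
  PairHEquiv.pairMap (A := graphPair F P Q) _ (fun _ hz => ⟨hP hz.1, hQ hz.2.1, hz.2.2⟩) hP _ _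
    (hEquiv_graph_fst hF h₁) (hEquiv_graph_fst hF h₂)

/-- Induced maps commute with inclusions, also if the multivalued map is enlarged: the graphs are
included in each other. -/
lemma inducedMap_naturality {F G : X → Set Y} (hFG : F ≤ G) {P P' : Set X × Set X}
    {Q Q' : Set Y × Set Y} (hP₁ : P.1 ⊆ P'.1) (hP₂ : P.2 ⊆ P'.2) (hQ₁ : Q.1 ⊆ Q'.1)
    (hQ₂ : Q.2 ⊆ Q'.2) (hF : PairHEquiv R (graphFst F P Q))
    (hG : PairHEquiv R (graphFst G P' Q')) :
    inducedMap.{u, v} R F P Q ≫ (relativeHomology.{u, v} R).map (pairIncl Q Q' hQ₁ hQ₂) =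
      (relativeHomology.{u, v} R).map (pairIncl P P' hP₁ hP₂) ≫ inducedMap.{u, v} R G P' Q' := by
  let γ : toPair (graphPair F P Q) ⟶ toPair (graphPair G P' Q') :=
    pairIncl _ _ (fun z hz => ⟨hP₁ hz.1, hQ₁ hz.2.1, hFG z.1 hz.2.2⟩)
      (fun z hz => ⟨hP₂ hz.1, hQ₂ hz.2.1, hFG z.1 hz.2.2⟩)
  have e₁ : graphFst F P Q ≫ pairIncl P P' hP₁ hP₂ = γ ≫ graphFst G P' Q' := rfl
  have e₂ : graphSnd F P Q ≫ pairIncl Q Q' hQ₁ hQ₂ = γ ≫ graphSnd G P' Q' := rfl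
  have := hF.isIso
  have := hG.isIso
  have e₃ := inverse_comp_eq_of_square (f := (relativeHomology.{u, v} R).map (graphFst F P Q))
    (f' := (relativeHomology.{u, v} R).map (graphFst G P' Q'))
    (g := (relativeHomology.{u, v} R).map γ)
    (h := (relativeHomology.{u, v} R).map (pairIncl P P' hP₁ hP₂))
    (by rw [← Functor.map_comp, ← Functor.map_comp, e₁])
  rw [inducedMap, inducedMap, Category.assoc, ← Functor.map_comp, e₂, Functor.map_comp,
    ← Category.assoc, e₃, Category.assoc]

end Induced

/-! ### Transfer maps -/

section Transfer

variable {R : Type u} [Ring R] {X : Type v} [TopologicalSpace X]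

/-- The multivalued map `F` maps the pair `P` into the pair `Q`, and `P' ⊆ Q` is an excision. -/
structure IsTransfer (R : Type u) [Ring R] (F : X → Set X) (P P' Q : Set X × Set X) : Prop where
  maps₁ : image F P.1 ⊆ Q.1
  maps₂ : image F P.2 ⊆ Q.2
  incl₁ : P'.1 ⊆ Q.1
  incl₂ : P'.2 ⊆ Q.2
  graph : PairHEquiv R (graphFst F P Q)
  excision : PairHEquiv R (pairIncl P' Q incl₁ incl₂)

/-- The composition `H(P) ⟶ H(Q) ≅ H(P')` of the map induced by `F` with the inverse of an
excision. The index map is the case `P = P'`, `Q = P̄`. -/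
def transfer {F : X → Set X} {P P' Q : Set X × Set X} (h : IsTransfer R F P P' Q) :
    (relativeHomology.{u, v} R).obj (toPair P) ⟶ (relativeHomology.{u, v} R).obj (toPair P') :=
  inducedMap.{u, v} R F P Q ≫
    inverse ((relativeHomology.{u, v} R).map (pairIncl P' Q h.incl₁ h.incl₂))

lemma transfer_naturality {F G : X → Set X} (hFG : F ≤ G) {P₀ P₁ P₀' P₁' Q₀ Q₁ : Set X × Set X}
    (h₀ : IsTransfer R F P₀ P₀' Q₀) (h₁ : IsTransfer R G P₁ P₁' Q₁)
    (hP₁ : P₀.1 ⊆ P₁.1) (hP₂ : P₀.2 ⊆ P₁.2) (hP₁' : P₀'.1 ⊆ P₁'.1) (hP₂' : P₀'.2 ⊆ P₁'.2)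
    (hQ₁ : Q₀.1 ⊆ Q₁.1) (hQ₂ : Q₀.2 ⊆ Q₁.2) :
    transfer h₀ ≫ (relativeHomology.{u, v} R).map (pairIncl P₀' P₁' hP₁' hP₂') =
      (relativeHomology.{u, v} R).map (pairIncl P₀ P₁ hP₁ hP₂) ≫ transfer h₁ := by
  have := h₀.excision.isIso
  have := h₁.excision.isIso
  have e : pairIncl P₀' Q₀ h₀.incl₁ h₀.incl₂ ≫ pairIncl Q₀ Q₁ hQ₁ hQ₂ =
    pairIncl P₀' P₁' hP₁' hP₂' ≫ pairIncl P₁' Q₁ h₁.incl₁ h₁.incl₂ := rfl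
  have e' := inverse_comp_eq_of_square
    (f := (relativeHomology.{u, v} R).map (pairIncl P₀' Q₀ h₀.incl₁ h₀.incl₂))
    (f' := (relativeHomology.{u, v} R).map (pairIncl P₁' Q₁ h₁.incl₁ h₁.incl₂))
    (g := (relativeHomology.{u, v} R).map (pairIncl P₀' P₁' hP₁' hP₂'))
    (h := (relativeHomology.{u, v} R).map (pairIncl Q₀ Q₁ hQ₁ hQ₂))
    (by rw [← Functor.map_comp, ← Functor.map_comp, e])
  rw [transfer, transfer, Category.assoc, e', ← Category.assoc,
    inducedMap_naturality hFG hP₁ hP₂ hQ₁ hQ₂ h₀.graph h₁.graph, Category.assoc]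

lemma map_pairIncl_self (P : Set X × Set X) :
    (relativeHomology.{u, v} R).map (pairIncl P P le_rfl le_rfl) = 𝟙 _ :=
  (relativeHomology.{u, v} R).map_id (toPair P)

lemma IsAdmissible.isTransfer [Finite X] [T0Space X] {F : X → Set X} (hF : IsAdmissible R F)
    {P P' Q : Set X × Set X} (hP : P.2 ⊆ P.1) (hP' : P'.2 ⊆ P'.1) (hQ : Q.2 ⊆ Q.1)
    (maps₁ : image F P.1 ⊆ Q.1) (maps₂ : image F P.2 ⊆ Q.2) (incl₁ : P'.1 ⊆ Q.1)
    (incl₂ : P'.2 ⊆ Q.2) (closed₁ : IsClosed P'.1) (closed₂ : IsClosed Q.2)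
    (exc : P'.1 \ P'.2 = Q.1 \ Q.2) : IsTransfer R F P P' Q where
  maps₁ := maps₁
  maps₂ := maps₂
  incl₁ := incl₁
  incl₂ := incl₂
  graph := pairHEquiv_graphFst hF hP hQ maps₁ maps₂
  excision := excision_pairIncl closed₁ closed₂ hP' hQ incl₁ incl₂ exc

end Transfer

/-! ### Endomorphisms and normal functors -/

section Normal

variable {E C : Type*} [Category* E] [Category* C]

/-- A morphism of endomorphisms whose underlying morphism is invertible is an isomorphism. -/
def Endo.isoOfIsIso {A B : Endo E} (φ : A ⟶ B) (h : IsIso (Endo.Hom.hom φ)) : A ≅ B where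
  hom := φ
  inv := ⟨inv (Endo.Hom.hom φ), by
    rw [IsIso.eq_inv_comp, ← Category.assoc, ← Endo.Hom.comm φ, Category.assoc, IsIso.hom_inv_id,
      Category.comp_id]⟩
  hom_inv_id := Endo.Hom.ext (IsIso.hom_inv_id _)
  inv_hom_id := Endo.Hom.ext (IsIso.inv_hom_id _)

/-- A normal functor inverts every morphism `φ : (A, a) ⟶ (B, b)` for which there is `ψ : B ⟶ A`
with `ψ φ = a` and `φ ψ = b`. -/
lemma IsNormal.isIso_map {L : Endo E ⥤ C} (hL : IsNormal L) {A B : Endo E} (φ : A ⟶ B)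
    (ψ : B.obj ⟶ A.obj) (h₁ : Endo.Hom.hom φ ≫ ψ = A.endo) (h₂ : ψ ≫ Endo.Hom.hom φ = B.endo) :
    IsIso (L.map φ) := by
  let ψ' : B ⟶ A := ⟨ψ, by rw [← h₁, ← h₂, Category.assoc]⟩
  have e₁ : L.map φ ≫ L.map ψ' = L.map A.induced := by
    rw [← L.map_comp]
    exact congrArg L.map (Endo.Hom.ext h₁)
  have e₂ : L.map ψ' ≫ L.map φ = L.map B.induced := by
    rw [← L.map_comp]
    exact congrArg L.map (Endo.Hom.ext h₂)
  have := hL A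
  have := hL B
  have : Epi (L.map φ) := by
    have : Epi (L.map ψ' ≫ L.map φ) := e₂ ▸ inferInstance
    exact epi_of_epi (L.map ψ') _
  have : IsSplitMono (L.map φ) := ⟨⟨L.map ψ' ≫ inv (L.map A.induced), by
    rw [← Category.assoc, e₁, IsIso.hom_inv_id]⟩⟩
  exact isIso_of_epi_of_isSplitMono _

end Normal

/-! ### Solutions of multivalued maps on finite sets -/

section Solutions

variable {X : Type v} {F : X → Set X}

lemma invPart_mono {A B : Set X} (h : A ⊆ B) : invPart F A ⊆ invPart F B :=
  fun _ hx => ⟨h hx.1, hx.2.imp fun _ hσ => ⟨⟨fun i => h (hσ.1.mem i), hσ.1.step⟩, hσ.2⟩⟩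

/-- A self-map of a nonempty finite type has a bi-infinite orbit. -/
lemma exists_int_orbit {D : Type*} [Finite D] [Nonempty D] (g : D → D) :
    ∃ τ : ℤ → D, ∀ i, τ (i + 1) = g (τ i) := by
  obtain ⟨x⟩ := ‹Nonempty D›
  obtain ⟨m, n, hmn, e⟩ : ∃ m n : ℕ, m < n ∧ g^[m] x = g^[n] x := by
    obtain ⟨m, n, h, e⟩ := Finite.exists_ne_map_eq_of_infinite fun n : ℕ => g^[n] x
    rcases h.lt_or_gt with h | h
    · exact ⟨m, n, h, e⟩
    · exact ⟨n, m, h, e.symm⟩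
  obtain ⟨p, hp, rfl⟩ : ∃ p : ℕ, 0 < p ∧ n = p + m := ⟨n - m, by omega, by omega⟩
  have hper : Function.IsPeriodicPt g p (g^[m] x) := by
    rw [Function.IsPeriodicPt, Function.IsFixedPt, ← Function.iterate_add_apply, ← e]
  refine ⟨fun i => g^[(i % p).toNat] (g^[m] x), fun i => ?_⟩
  have hp' : (0 : ℤ) < p := by exact_mod_cast hp
  have h : ((i + 1) % p).toNat = ((i % p).toNat + 1) % p := by
    have h₀ := Int.emod_nonneg i hp'.ne'
    rw [← Int.emod_add_emod]
    zify
    rw [Int.toNat_of_nonneg (Int.emod_nonneg _ hp'.ne'), Int.toNat_of_nonneg h₀]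
  dsimp only
  rw [h, hper.iterate_mod_apply, Function.iterate_succ_apply']

lemma invPart_nonempty_of_forward [Finite X] {D : Set X} (hD : D.Nonempty)
    (h : ∀ x ∈ D, ∃ y ∈ D, y ∈ F x) : (invPart F D).Nonempty := by
  choose g hg hgF using fun x : D => h x.1 x.2
  have := hD.to_subtype
  obtain ⟨τ, hτ⟩ := exists_int_orbit fun x : D => (⟨g x, hg x⟩ : D)
  refine ⟨τ 0, (τ 0).2, fun i => τ i, ⟨fun i => (τ i).2, fun i => ?_⟩, 0, rfl⟩
  rw [hτ]
  exact hgF _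

lemma invPart_nonempty_of_backward [Finite X] {D : Set X} (hD : D.Nonempty)
    (h : ∀ x ∈ D, ∃ y ∈ D, x ∈ F y) : (invPart F D).Nonempty := by
  choose g hg hgF using fun x : D => h x.1 x.2
  have := hD.to_subtype
  obtain ⟨τ, hτ⟩ := exists_int_orbit fun x : D => (⟨g x, hg x⟩ : D)
  refine ⟨τ 0, (τ 0).2, fun i => τ (-i), ⟨fun i => (τ _).2, fun i => ?_⟩, 0, rfl⟩
  have e : τ (-i) = ⟨g (τ (-(i + 1))), hg _⟩ := by
    rw [← hτ]
    congr 1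
    ring
  rw [e]
  exact hgF _

lemma IsInvariant.exists_mem_image {S : Set X} (hS : IsInvariant F S) {x : X} (hx : x ∈ S) :
    ∃ y ∈ S, y ∈ F x := by
  obtain ⟨σ, hσ, i, rfl⟩ := hS x hx
  exact ⟨_, hσ.mem _, hσ.step i⟩

lemma IsInvariant.exists_mem_preimage {S : Set X} (hS : IsInvariant F S) {x : X} (hx : x ∈ S) :
    ∃ y ∈ S, x ∈ F y := by
  obtain ⟨σ, hσ, i, rfl⟩ := hS x hx
  refine ⟨_, hσ.mem (i - 1), ?_⟩
  simpa using hσ.step (i - 1)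

/-- The points reached from `S` by the paths in `N` starting in `S`. -/
def reach (F : X → Set X) (S N : Set X) : Set X :=
  {x | x ∈ N ∧ ∃ a ∈ S, Relation.ReflTransGen (fun y z => z ∈ F y ∧ z ∈ N) a x}

lemma reach_subset {S N : Set X} : reach F S N ⊆ N := fun _ hx => hx.1

lemma reach_mono {S N M : Set X} (h : N ⊆ M) : reach F S N ⊆ reach F S M :=
  fun _ ⟨hx, a, ha, r⟩ => ⟨h hx, a, ha, 
    Relation.ReflTransGen.mono (fun _ _ hz => ⟨hz.1, h hz.2⟩) _ _ r⟩

lemma mem_reach_of_mem {S N : Set X} {x y : X} (hx : x ∈ reach F S N) (hy : y ∈ F x)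
    (hyN : y ∈ N) : y ∈ reach F S N :=
  let ⟨_, a, ha, r⟩ := hx
  ⟨hyN, a, ha, r.tail ⟨hy, hyN⟩⟩

lemma image_reach_subset {S N : Set X} : image F (reach F S N) ∩ N ⊆ reach F S N := by
  rintro y ⟨hy, hyN⟩
  obtain ⟨x, hx, hxy⟩ := mem_image.1 hy
  exact mem_reach_of_mem hx hxy hyN

lemma reach_subset_of_forward {S N B : Set X} (hS : S ⊆ B) (hB : image F B ∩ N ⊆ B) :
    reach F S N ⊆ B := by
  rintro x ⟨-, a, ha, r⟩
  induction r with
  | refl => exact hS ha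
  | tail _ h ih => exact hB ⟨mem_image.2 ⟨_, ih, h.1⟩, h.2⟩

lemma subset_reach {S N : Set X} (h : S ⊆ N) : S ⊆ reach F S N :=
  fun x hx => ⟨h hx, x, hx, .refl⟩

lemma exists_mem_reach {S N : Set X} (hS : IsInvariant F S) (hSN : S ⊆ N) {x : X}
    (hx : x ∈ reach F S N) : ∃ y ∈ reach F S N, x ∈ F y := by
  obtain ⟨hxN, a, ha, r⟩ := hx
  rcases Relation.ReflTransGen.cases_tail r with rfl | ⟨y, r', h⟩
  · obtain ⟨y, hy, hxy⟩ := hS.exists_mem_preimage ha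
    exact ⟨y, subset_reach hSN hy, hxy⟩
  · refine ⟨y, ⟨?_, a, ha, r'⟩, h.1⟩
    rcases Relation.ReflTransGen.cases_tail r' with rfl | ⟨_, _, h'⟩
    exacts [hSN ha, h'.2]

/-- Prolonging a path along a chain of successors. -/
lemma IsPath.exists_extension {N : Set X} {m n : ℤ} {σ : ℤ → X} (hσ : IsPath F N m n σ) {b : X}
    (r : Relation.ReflTransGen (fun y z => z ∈ F y ∧ z ∈ N) (σ n) b) :
    ∃ n' τ, n ≤ n' ∧ IsPath F N m n' τ ∧ τ n' = b ∧ ∀ i ≤ n, τ i = σ i := by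
  induction r with
  | refl => exact ⟨n, σ, le_rfl, hσ, rfl, fun _ _ => rfl⟩
  | @tail y z _ h ih =>
    obtain ⟨n', τ, hn, hτ, rfl, e⟩ := ih
    have hne : ∀ i ≤ n', Function.update τ (n' + 1) z i = τ i := fun i hi =>
      Function.update_of_ne (by omega) _ _
    refine ⟨n' + 1, Function.update τ (n' + 1) z, by omega, ⟨by have := hτ.le; omega, ?_, ?_⟩,
      Function.update_self _ _ _, fun i hi => (hne i (by omega)).trans (e i hi)⟩
    · intro i h₁ h₂
      rcases h₂.lt_or_eq with h₂ | rfl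
      · rw [hne i (by omega)]
        exact hτ.mem i h₁ (by omega)
      · rw [Function.update_self]
        exact h.2
    · intro i h₁ h₂
      rw [hne i (by omega)]
      rcases h₂.lt_or_eq with h₂ | h₂
      · rw [hne _ (by omega)]
        exact hτ.step i h₁ (by omega)
      · obtain rfl : i = n' := by omega
        rw [Function.update_self]
        exact h.1

end Solutions

/-! ### Isolating sets -/

section Isolating

variable {X : Type v} [TopologicalSpace X] {F : X → Set X} {S N M : Set X}

lemma mem_closure_iff_exists_specializes [Finite X] {A : Set X} {x : X} :
    x ∈ closure A ↔ ∃ a ∈ A, a ⤳ x := by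
  refine ⟨fun h => ?_, fun ⟨a, ha, h⟩ => h.mem_closed isClosed_closure (subset_closure ha)⟩
  obtain ⟨a, ha, haA⟩ := mem_closure_iff.1 h (nhdsKer {x}) isOpen_nhdsKer (subset_nhdsKer rfl)
  exact ⟨a, haA, mem_nhdsKer_singleton.1 ha⟩

lemma isClosed_of_forall_specializes [Finite X] {A : Set X}
    (h : ∀ x y, x ∈ A → x ⤳ y → y ∈ A) : IsClosed A :=
  isClosed_of_closure_subset fun _ hy =>
    let ⟨_, hx, hxy⟩ := mem_closure_iff_exists_specializes.1 hy
    h _ _ hx hxy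

/-- A point of `S` is in the image of `S`, so it would lie in `F(S) \ N` if it were not in `N`. -/
lemma IsIsolating.subset (h : IsIsolating F S N) : S ⊆ N := by
  intro x hx
  by_contra hxN
  obtain ⟨y, hy, hxy⟩ := h.invariant.exists_mem_preimage hx
  exact h.disjoint.subset ⟨hx, subset_closure ⟨mem_image.2 ⟨y, hy, hxy⟩, hxN⟩⟩

lemma IsIsolating.inter (hN : IsIsolating F S N) (hM : IsIsolating F S M) :
    IsIsolating F S (N ∩ M) where
  invariant := hN.invariant
  closed := hN.closed.inter hM.closed
  path m n σ hσ := hN.path m n σ ⟨hσ.le, fun i h₁ h₂ => (hσ.mem i h₁ h₂).1, hσ.step⟩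
  disjoint := by
    rw [Set.sdiff_inter, closure_union, Set.inter_union_distrib_left, hN.disjoint, hM.disjoint,
      Set.union_empty]

/-- A point of a path in `N` from `S` to `S` lies in `S`. -/
lemma IsIsolating.mem_of_reach (h : IsIsolating F S N) {x b : X} (hx : x ∈ reach F S N)
    (hb : b ∈ S) (r : Relation.ReflTransGen (fun y z => z ∈ F y ∧ z ∈ N) x b) : x ∈ S := by
  obtain ⟨-, a, ha, r'⟩ := hx
  have h₀ : IsPath F N 0 0 fun _ => a := ⟨le_rfl, fun _ _ _ => h.subset ha, fun _ _ _ => by omega⟩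
  obtain ⟨n, σ, hn, hσ, rfl, hσ'⟩ := h₀.exists_extension r'
  obtain ⟨n', τ, hn', hτ, rfl, hτ'⟩ := hσ.exists_extension r
  rw [← hτ' n le_rfl]
  refine h.path 0 n' τ hτ ?_ hb n hn hn'
  rw [hτ' 0 hn, hσ' 0 le_rfl]
  exact ha

lemma IsIsolating.mem_of_mem_image (h : IsIsolating F S N) {x b : X} (hx : x ∈ reach F S N)
    (hb : b ∈ S) (hbx : b ∈ F x) : x ∈ S :=
  h.mem_of_reach hx hb (.single ⟨hbx, h.subset hb⟩)

/-- The conditions on an index pair that do not refer to the isolated invariant set. -/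
structure IsPreIndexPair (F : X → Set X) (N : Set X) (P : Set X × Set X) : Prop where
  closed₁ : IsClosed P.1
  closed₂ : IsClosed P.2
  sub : P.2 ⊆ P.1
  sub_N : P.1 ⊆ N
  ip1₁ : image F P.1 ∩ N ⊆ P.1
  ip1₂ : image F P.2 ∩ N ⊆ P.2
  ip2 : P.1 ∩ closure (image F P.1 \ N) ⊆ P.2

lemma IsIndexPair.isPreIndexPair {P : Set X × Set X} (h : IsIndexPair F S N P) :
    IsPreIndexPair F N P :=
  ⟨h.closed₁, h.closed₂, h.sub, h.sub_N, h.ip1₁, h.ip1₂, h.ip2⟩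

variable [Finite X] {R : Type u} [Ring R]

lemma IsAdmissible.isClosed_image (hF : IsAdmissible R F) (B : Set X) : IsClosed (image F B) :=
  isClosed_iUnion₂ fun x _ => hF.closed x

lemma IsIsolating.isClosed_reach (h : IsIsolating F S N) (hF : IsAdmissible R F) :
    IsClosed (reach F S N) :=
  isClosed_of_forall_specializes fun x y hx hxy => by
    obtain ⟨w, hw, hxw⟩ := exists_mem_reach h.invariant h.subset hx
    exact mem_reach_of_mem hw (hxy.mem_closed (hF.closed w) hxw)
      (hxy.mem_closed h.closed (reach_subset hx))

/-- The points reached from `S` in an isolating set `N`, and those of them outside `S`, form an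
index pair. -/
lemma IsIsolating.isIndexPair_reach (h : IsIsolating F S N) (hF : IsAdmissible R F) :
    IsIndexPair F S N (reach F S N, reach F S N \ S) where
  isolating := h
  closed₁ := h.isClosed_reach hF
  closed₂ := isClosed_of_forall_specializes fun x y hx hxy => by
    refine ⟨hxy.mem_closed (h.isClosed_reach hF) hx.1, fun hy => hx.2 ?_⟩
    obtain ⟨z, hz, hyz⟩ := h.invariant.exists_mem_image hy
    exact h.mem_of_mem_image hx.1 hz (hF.anti hxy hyz)
  sub := Set.sdiff_subset
  sub_N := reach_subset
  ip1₁ := image_reach_subset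
  ip1₂ := by
    rintro y ⟨hy, hyN⟩
    obtain ⟨x, hx, hxy⟩ := mem_image.1 hy
    exact ⟨mem_reach_of_mem hx.1 hxy hyN, fun hyS => hx.2 (h.mem_of_mem_image hx.1 hyS hxy)⟩
  ip2 := by
    rintro x ⟨hx, hxc⟩
    refine ⟨hx, fun hxS => ?_⟩
    obtain ⟨w, ⟨hw, hwN⟩, hwx⟩ := mem_closure_iff_exists_specializes.1 hxc
    obtain ⟨y, hy, hyw⟩ := mem_image.1 hw
    have hyS := h.mem_of_mem_image hy hxS (hwx.mem_closed (hF.closed y) hyw)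
    exact h.disjoint.subset ⟨hxS, mem_closure_iff_exists_specializes.2
      ⟨w, ⟨mem_image.2 ⟨y, hyS, hyw⟩, hwN⟩, hwx⟩⟩
  ip3 := by
    dsimp only
    rw [Set.sdiff_sdiff_cancel_left (subset_reach h.subset)]
    exact Set.Subset.antisymm (fun x hx => ⟨hx, h.invariant x hx⟩) fun _ hx => hx.1

end Isolating

/-! ### Comparison of index maps -/

section Comparison

lemma diff_eq_union_diff_union {α : Type*} {A B C : Set α} (h : A ∩ C ⊆ B) :
    A \ B = (A ∪ C) \ (B ∪ C) := by
  ext x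
  have := @h x
  simp only [Set.mem_sdiff, Set.mem_union, Set.mem_inter_iff] at *
  tauto

variable {R : Type u} [Ring R] {X : Type v} [TopologicalSpace X] {F : X → Set X}
  {N M : Set X} {P Q : Set X × Set X}

variable [Finite X] [T0Space X]

lemma IsPreIndexPair.isTransfer (hF : IsAdmissible R F) (hP : IsPreIndexPair F N P) :
    IsTransfer R F P P (extend F N P) :=
  hF.isTransfer hP.sub hP.sub (Set.union_subset_union_left _ hP.sub)
    (fun y hy => by
      by_cases hyN : y ∈ N
      exacts [Or.inl (hP.ip1₁ ⟨hy, hyN⟩), Or.inr (subset_closure ⟨hy, hyN⟩)])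
    (fun y hy => by
      by_cases hyN : y ∈ N
      exacts [Or.inl (hP.ip1₂ ⟨hy, hyN⟩), Or.inr (subset_closure ⟨image_mono hP.sub hy, hyN⟩)])
    Set.subset_union_left Set.subset_union_left hP.closed₁ (hP.closed₂.union isClosed_closure)
    (diff_eq_union_diff_union hP.ip2)

lemma IsIndexPair.indexMapDefined {S : Set X} (hF : IsAdmissible R F) (hP : IsIndexPair F S N P) :
    IndexMapDefined R F N P :=
  have h := hP.isPreIndexPair.isTransfer hF
  ⟨h.maps₁, h.maps₂, h.graph.isIso, h.excision.isIso⟩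

/-- If `P` satisfies the conditions on an index pair for `F ≤ G`, possibly in different isolating
sets, then the index maps of `F` and `G` are equal. -/
lemma indexMap_eq_of_le {G : X → Set X} (hF : IsAdmissible R F) (hG : IsAdmissible R G)
    (hFG : F ≤ G) (hP : IsPreIndexPair F N P) (hP' : IsPreIndexPair G M P) :
    indexMap.{u, v} R F N P = indexMap.{u, v} R G M P := by
  have hc : closure (image F P.1 \ N) ⊆ closure (image G P.1 \ M) := closure_mono fun y hy => by
    obtain ⟨x, hx, hxy⟩ := mem_image.1 hy.1
    have hy' : y ∈ image G P.1 := mem_image.2 ⟨x, hx, hFG x hxy⟩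
    exact ⟨hy', fun hyM => hy.2 (hP.sub_N (hP'.ip1₁ ⟨hy', hyM⟩))⟩
  have := transfer_naturality hFG (hP.isTransfer hF) (hP'.isTransfer hG) le_rfl le_rfl le_rfl le_rfl
    (Set.union_subset_union_right _ hc) (Set.union_subset_union_right _ hc)
  rwa [map_pairIncl_self, Category.comp_id, Category.id_comp] at this

variable {L : Endo (GrMod.{u, v} R) ⥤ Auto (GrMod.{u, v} R)}

/-- Pairs with the same difference, one contained in the other, have conjugate index maps, by
excision. -/
lemma nonempty_iso_of_diff_eq (hF : IsAdmissible R F) (hP : IsPreIndexPair F N P)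
    (hQ : IsPreIndexPair F M Q) (h₁ : P.1 ⊆ Q.1) (h₂ : P.2 ⊆ Q.2) (h : P.1 \ P.2 = Q.1 \ Q.2) :
    Nonempty (L.obj (indexObj R F N P) ≅ L.obj (indexObj R F M Q)) := by
  have hc : closure (image F P.1 \ N) ⊆ Q.2 ∪ closure (image F Q.1 \ M) := by
    refine closure_minimal (fun y hy => ?_) (hQ.closed₂.union isClosed_closure)
    have hy' := image_mono h₁ hy.1
    by_cases hyM : y ∈ M
    · refine Or.inl (by_contra fun hyQ => hy.2 (hP.sub_N ?_))
      exact (h.superset ⟨hQ.ip1₁ ⟨hy', hyM⟩, hyQ⟩).1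
    · exact Or.inr (subset_closure ⟨hy', hyM⟩)
  have e := transfer_naturality le_rfl (hP.isTransfer hF) (hQ.isTransfer hF) h₁ h₂ h₁ h₂
    (Set.union_subset (h₁.trans Set.subset_union_left)
      (hc.trans (Set.union_subset_union_left _ hQ.sub)))
    (Set.union_subset (h₂.trans Set.subset_union_left) hc)
  let φ : indexObj R F N P ⟶ indexObj R F M Q :=
    ⟨(relativeHomology.{u, v} R).map (pairIncl P Q h₁ h₂), e⟩
  exact ⟨L.mapIso (Endo.isoOfIsIso φ
    (excision_pairIncl hP.closed₁ hQ.closed₂ hP.sub hQ.sub h₁ h₂ h).isIso)⟩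

/-- If `F` maps the pair `Q` into the smaller pair `P`, up to points outside `N`, then the index map
of `Q` and that of `P` are the two compositions of the inclusion `P ⟶ Q` with a transfer map from
`Q` to `P`, so a normal functor does not tell them apart. -/
lemma nonempty_iso_of_image_subset (hL : IsNormal L) (hF : IsAdmissible R F)
    (hP : IsPreIndexPair F N P) (hQ : IsPreIndexPair F N Q) (h₁ : P.1 ⊆ Q.1) (h₂ : P.2 ⊆ Q.2)
    (hQ₁ : image F Q.1 ∩ N ⊆ P.1) (hQ₂ : image F Q.2 ∩ N ⊆ P.2)
    (h : P.1 ∩ closure (image F Q.1 \ N) ⊆ P.2) :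
    Nonempty (L.obj (indexObj R F N P) ≅ L.obj (indexObj R F N Q)) := by
  have hT : IsTransfer R F Q P
      (P.1 ∪ closure (image F Q.1 \ N), P.2 ∪ closure (image F Q.1 \ N)) :=
    hF.isTransfer hQ.sub hP.sub (Set.union_subset_union_left _ hP.sub)
      (fun y hy => by
        by_cases hyN : y ∈ N
        exacts [Or.inl (hQ₁ ⟨hy, hyN⟩), Or.inr (subset_closure ⟨hy, hyN⟩)])
      (fun y hy => by
        by_cases hyN : y ∈ N
        exacts [Or.inl (hQ₂ ⟨hy, hyN⟩), Or.inr (subset_closure ⟨image_mono hQ.sub hy, hyN⟩)])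
      Set.subset_union_left Set.subset_union_left hP.closed₁
      (hP.closed₂.union isClosed_closure) (diff_eq_union_diff_union h)
  have hc : closure (image F P.1 \ N) ⊆ closure (image F Q.1 \ N) :=
    closure_mono (Set.sdiff_subset_sdiff_left (image_mono h₁))
  have e₁ := transfer_naturality le_rfl (hP.isTransfer hF) hT h₁ h₂ le_rfl le_rfl
    (Set.union_subset_union_right _ hc) (Set.union_subset_union_right _ hc)
  have e₂ := transfer_naturality le_rfl hT (hQ.isTransfer hF) le_rfl le_rfl h₁ h₂
    (Set.union_subset_union_left _ h₁) (Set.union_subset_union_left _ h₂)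
  rw [map_pairIncl_self, Category.comp_id] at e₁
  rw [map_pairIncl_self, Category.id_comp] at e₂
  let φ : indexObj R F N P ⟶ indexObj R F N Q :=
    ⟨(relativeHomology.{u, v} R).map (pairIncl P Q h₁ h₂), by
      change transfer (hP.isTransfer hF) ≫ _ = _ ≫ transfer (hQ.isTransfer hF)
      rw [e₁, ← e₂, Category.assoc]⟩
  have := hL.isIso_map φ (transfer hT) e₁.symm e₂
  exact ⟨asIso (L.map φ)⟩

end Comparison

/-! ### Independence of the index pair -/

section Independence

variable {R : Type u} [Ring R] {X : Type v} [TopologicalSpace X] {F : X → Set X}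
  {S N M : Set X} {P Q : Set X × Set X} [Finite X] [T0Space X]
  {L : Endo (GrMod.{u, v} R) ⥤ Auto (GrMod.{u, v} R)}

/-- The exit set of a pair `(C, A)` can be enlarged to `E` if every invariant set between them is
empty. -/
lemma nonempty_iso_of_exit_subset (hL : IsNormal L) (hF : IsAdmissible R F) {C A E : Set X}
    (hA : IsPreIndexPair F N (C, A)) (hE : IsPreIndexPair F N (C, E)) (hAE : A ⊆ E)
    (hinv : invPart F (E \ A) = ∅) :
    Nonempty (L.obj (indexObj R F N (C, A)) ≅ L.obj (indexObj R F N (C, E))) := by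
  induction A using WellFoundedGT.induction with
  | ind A ih =>
  obtain rfl | hne := eq_or_ne A E
  · exact ⟨Iso.refl _⟩
  -- `F` maps the pair `(C, A')` into `(C, A)`
  let A' : Set X := {x | x ∈ E ∧ F x ∩ N ⊆ A}
  have hAA' : A ⊆ A' := fun x hx =>
    ⟨hAE hx, fun y hy => hA.ip1₂ ⟨mem_image.2 ⟨x, hx, hy.1⟩, hy.2⟩⟩
  have himage : image F A' ∩ N ⊆ A := fun y hy => by
    obtain ⟨x, hx, hxy⟩ := mem_image.1 hy.1
    exact hx.2 ⟨hxy, hy.2⟩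
  have hA' : IsPreIndexPair F N (C, A') :=
    { closed₁ := hA.closed₁
      closed₂ := isClosed_of_forall_specializes fun x y hx hxy =>
        ⟨hxy.mem_closed hE.closed₂ hx.1,
          (Set.inter_subset_inter_left _ (hF.anti hxy)).trans hx.2⟩
      sub := fun x hx => hE.sub hx.1
      sub_N := hA.sub_N
      ip1₁ := hA.ip1₁
      ip1₂ := himage.trans hAA'
      ip2 := hA.ip2.trans hAA' }
  have hlt : A < A' := by
    refine lt_of_le_of_ne hAA' fun e => ?_
    refine (invPart_nonempty_of_forward (F := F) (D := E \ A)
      (Set.sdiff_nonempty.2 fun h => hne (hAE.antisymm h)) fun x hx => ?_).ne_empty hinv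
    obtain ⟨y, hy, hyA⟩ : ∃ y ∈ F x ∩ N, y ∉ A := Set.not_subset.1 fun h => by
      apply hx.2
      rw [e]
      exact ⟨hx.1, h⟩
    exact ⟨y, ⟨hE.ip1₂ ⟨mem_image.2 ⟨x, hx.1, hy.1⟩, hy.2⟩, hyA⟩, hy.1⟩
  obtain ⟨i⟩ := nonempty_iso_of_image_subset hL hF hA hA' le_rfl hAA' hA.ip1₁ himage hA.ip2
  obtain ⟨j⟩ := ih A' hlt hA' (fun x hx => hx.1) (Set.subset_empty_iff.1
    ((invPart_mono (Set.sdiff_subset_sdiff_right hAA')).trans hinv.subset))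
  exact ⟨i ≪≫ j⟩

/-- The first set of a pair `(B, A)` can be shrunk to `C` if every invariant set between them is
empty. -/
lemma nonempty_iso_of_first_subset (hL : IsNormal L) (hF : IsAdmissible R F) {A B C : Set X}
    (hN : IsClosed N) (hC : IsPreIndexPair F N (C, A)) (hB : IsPreIndexPair F N (B, A))
    (hCB : C ⊆ B)
    (hinv : invPart F (B \ C) = ∅) :
    Nonempty (L.obj (indexObj R F N (C, A)) ≅ L.obj (indexObj R F N (B, A))) := by
  induction B using WellFoundedLT.induction with
  | ind B ih =>
  obtain rfl | hne := eq_or_ne B C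
  · exact ⟨Iso.refl _⟩
  -- `F` maps the pair `(B, A)` into `(B', A)`
  let B' : Set X := image F B ∩ N ∪ C
  have hB'B : B' ⊆ B := Set.union_subset hB.ip1₁ hCB
  have hB' : IsPreIndexPair F N (B', A) :=
    { closed₁ := ((hF.isClosed_image B).inter hN).union hC.closed₁
      closed₂ := hC.closed₂
      sub := hC.sub.trans Set.subset_union_right
      sub_N := hB'B.trans hB.sub_N
      ip1₁ := (Set.inter_subset_inter_left _ (image_mono hB'B)).trans Set.subset_union_left
      ip1₂ := hC.ip1₂
      ip2 := (Set.inter_subset_inter hB'B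
        (closure_mono (Set.sdiff_subset_sdiff_left (image_mono hB'B)))).trans hB.ip2 }
  have hlt : B' < B := by
    refine lt_of_le_of_ne hB'B fun e => ?_
    refine (invPart_nonempty_of_backward (F := F) (D := B \ C)
      (Set.sdiff_nonempty.2 fun h => hne (h.antisymm hCB)) fun x hx => ?_).ne_empty hinv
    obtain hx' | hx' := e.superset hx.1
    · obtain ⟨y, hy, hyx⟩ := mem_image.1 hx'.1
      exact ⟨y, ⟨hy, fun hyC => hx.2 (hC.ip1₁ ⟨mem_image.2 ⟨y, hyC, hyx⟩, hx'.2⟩)⟩, hyx⟩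
    · exact absurd hx' hx.2
  obtain ⟨i⟩ := nonempty_iso_of_image_subset hL hF hB' hB hB'B le_rfl Set.subset_union_left
    hC.ip1₂ ((Set.inter_subset_inter_left _ hB'B).trans hB.ip2)
  obtain ⟨j⟩ := ih B' hlt hB' Set.subset_union_right (Set.subset_empty_iff.1
    ((invPart_mono (Set.sdiff_subset_sdiff_left hB'B)).trans hinv.subset))
  exact ⟨j ≪≫ i⟩

/-- Every index pair `(Q₁, Q₂)` in `N` has the index of the canonical pair `(C, C \ S)` of the
points reached from `S`, by way of `(C, C ∩ Q₂)` and `(C ∪ Q₂, Q₂)`. -/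
lemma IsIndexPair.nonempty_iso_reach (hL : IsNormal L) (hF : IsAdmissible R F)
    (hQ : IsIndexPair F S N Q) :
    Nonempty (L.obj (indexObj R F N (reach F S N, reach F S N \ S)) ≅
      L.obj (indexObj R F N Q)) := by
  obtain ⟨Q₁, Q₂⟩ := Q
  have hS : S ⊆ Q₁ \ Q₂ := fun x hx => (hQ.ip3.subset hx).1
  have hC := (hQ.isolating.isIndexPair_reach hF).isPreIndexPair
  have hSC : S ⊆ reach F S N := subset_reach hQ.isolating.subset
  set C := reach F S N
  have hCQ : C ⊆ Q₁ := reach_subset_of_forward (hS.trans Set.sdiff_subset) hQ.ip1₁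
  -- an invariant set in `Q₁ \ Q₂` that misses `S` is empty
  have hinv : ∀ D, D ⊆ Q₁ \ Q₂ → Disjoint D S → invPart F D = ∅ := fun D hD hDS =>
    Set.eq_empty_of_forall_notMem fun x hx =>
      Set.disjoint_left.1 hDS hx.1 (hQ.ip3.superset (invPart_mono hD hx))
  have h₁ : IsPreIndexPair F N (C, C ∩ Q₂) :=
    { closed₁ := hC.closed₁
      closed₂ := hC.closed₁.inter hQ.closed₂
      sub := Set.inter_subset_left
      sub_N := hC.sub_N
      ip1₁ := hC.ip1₁
      ip1₂ := fun y hy => ⟨hC.ip1₁ ⟨image_mono Set.inter_subset_left hy.1, hy.2⟩,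
        hQ.ip1₂ ⟨image_mono Set.inter_subset_right hy.1, hy.2⟩⟩
      ip2 := fun y hy => ⟨hy.1, hQ.ip2 ⟨hCQ hy.1,
        closure_mono (Set.sdiff_subset_sdiff_left (image_mono hCQ)) hy.2⟩⟩ }
  have hCQ' : C ∪ Q₂ ⊆ Q₁ := Set.union_subset hCQ hQ.sub
  have h₂ : IsPreIndexPair F N (C ∪ Q₂, Q₂) :=
    { closed₁ := hC.closed₁.union hQ.closed₂
      closed₂ := hQ.closed₂
      sub := Set.subset_union_right
      sub_N := hCQ'.trans hQ.sub_N
      ip1₁ := by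
        rintro y ⟨hy, hyN⟩
        obtain ⟨x, hx | hx, hxy⟩ := mem_image.1 hy
        · exact Or.inl (hC.ip1₁ ⟨mem_image.2 ⟨x, hx, hxy⟩, hyN⟩)
        · exact Or.inr (hQ.ip1₂ ⟨mem_image.2 ⟨x, hx, hxy⟩, hyN⟩)
      ip1₂ := hQ.ip1₂
      ip2 := fun y hy => hQ.ip2 ⟨hCQ' hy.1,
        closure_mono (Set.sdiff_subset_sdiff_left (image_mono hCQ')) hy.2⟩ }
  obtain ⟨i⟩ := nonempty_iso_of_exit_subset hL hF h₁ hC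
    (fun x hx => ⟨hx.1, fun hxS => (hS hxS).2 hx.2⟩)
    (hinv _ (fun x hx => ⟨hCQ hx.1.1, fun hxQ => hx.2 ⟨hx.1.1, hxQ⟩⟩)
      (Set.disjoint_left.2 fun x hx => hx.1.2))
  obtain ⟨j⟩ := nonempty_iso_of_diff_eq (L := L) hF h₁ h₂ Set.subset_union_left
    Set.inter_subset_right (by rw [Set.sdiff_self_inter, Set.union_sdiff_right])
  obtain ⟨k⟩ := nonempty_iso_of_first_subset hL hF hQ.isolating.closed h₂ hQ.isPreIndexPair hCQ'
    (hinv _ (fun x hx => ⟨hx.1, fun hxQ => hx.2 (Or.inr hxQ)⟩)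
      (Set.disjoint_left.2 fun x hx hxS => hx.2 (Or.inl (hSC hxS))))
  exact ⟨i.symm ≪≫ j ≪≫ k⟩

/-- The canonical pairs of two isolating sets `N ⊆ M` have the same difference `S`. -/
lemma IsIsolating.nonempty_iso_reach_of_subset (hF : IsAdmissible R F) (hN : IsIsolating F S N)
    (hM : IsIsolating F S M) (h : N ⊆ M) :
    Nonempty (L.obj (indexObj R F N (reach F S N, reach F S N \ S)) ≅
      L.obj (indexObj R F M (reach F S M, reach F S M \ S))) := by
  refine nonempty_iso_of_diff_eq hF (hN.isIndexPair_reach hF).isPreIndexPair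
    (hM.isIndexPair_reach hF).isPreIndexPair (reach_mono h)
    (Set.sdiff_subset_sdiff_left (reach_mono h)) ?_
  dsimp only
  rw [Set.sdiff_sdiff_cancel_left (subset_reach hN.subset),
    Set.sdiff_sdiff_cancel_left (subset_reach hM.subset)]

/-- The Conley index depends neither on the isolating set nor on the index pair. -/
theorem IsIndexPair.nonempty_iso (hL : IsNormal L) (hF : IsAdmissible R F)
    (hP : IsIndexPair F S N P) (hQ : IsIndexPair F S M Q) :
    Nonempty (L.obj (indexObj R F N P) ≅ L.obj (indexObj R F M Q)) := by
  have hNM := hP.isolating.inter hQ.isolating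
  obtain ⟨i⟩ := hP.nonempty_iso_reach hL hF
  obtain ⟨j⟩ := hQ.nonempty_iso_reach hL hF
  obtain ⟨k⟩ := hNM.nonempty_iso_reach_of_subset (L := L) hF hP.isolating Set.inter_subset_left
  obtain ⟨l⟩ := hNM.nonempty_iso_reach_of_subset (L := L) hF hQ.isolating Set.inter_subset_right
  exact ⟨i.symm ≪≫ k.symm ≪≫ l ≪≫ j⟩

theorem IsIsolatedInvariant.conleyIndexDefined (hF : IsAdmissible R F)
    (hS : IsIsolatedInvariant F S) : ConleyIndexDefined R F S :=
  ⟨hS.imp fun _ hN => ⟨_, hN.isIndexPair_reach hF⟩, fun _ _ hP => hP.indexMapDefined hF⟩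

/-- The Conley index is invariant under elementary continuations. -/
lemma ElementaryContinuation.nonempty_iso {G : X → Set X} {S_F S_G : Set X} (hL : IsNormal L)
    (h : ElementaryContinuation R F G S_F S_G) (hP : IsIndexPair F S_F N P)
    (hQ : IsIndexPair G S_G M Q) :
    Nonempty (L.obj (indexObj R F N P) ≅ L.obj (indexObj R G M Q)) := by
  obtain ⟨N_F, N_G, P', h_F, h_G⟩ := h.pair
  obtain ⟨i⟩ := hP.nonempty_iso hL h.admissible_F h_F
  obtain ⟨j⟩ := h_G.nonempty_iso hL h.admissible_G hQ
  have e : indexMap R F N_F P' = indexMap R G N_G P' := by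
    obtain hle | hle := h.comparable
    · exact indexMap_eq_of_le h.admissible_F h.admissible_G hle h_F.isPreIndexPair
        h_G.isPreIndexPair
    · exact (indexMap_eq_of_le h.admissible_G h.admissible_F hle h_G.isPreIndexPair
        h_F.isPreIndexPair).symm
  have e' : indexObj R F N_F P' = indexObj R G N_G P' := by rw [indexObj, indexObj, e]
  exact ⟨i ≪≫ L.mapIso (eqToIso e') ≪≫ j⟩

theorem RelatedByContinuation.nonempty_iso {G : X → Set X} {S_F S_G : Set X} (hL : IsNormal L)
    (h : RelatedByContinuation R F G S_F S_G) (hP : IsIndexPair F S_F N P)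
    (hQ : IsIndexPair G S_G M Q) :
    Nonempty (L.obj (indexObj R F N P) ≅ L.obj (indexObj R G M Q)) := by
  obtain ⟨k, Φ, T, rfl, rfl, rfl, rfl, hΦ, -, hel⟩ := h
  induction k generalizing M Q with
  | zero => exact hP.nonempty_iso hL (hΦ 0 le_rfl).1 hQ
  | succ k ih =>
    obtain ⟨hk, hTk⟩ := hΦ k k.le_succ
    obtain ⟨N', P', hP'⟩ := (hTk.conleyIndexDefined hk).1
    obtain ⟨i⟩ := ih hP' (fun j hj => hΦ j (hj.trans k.le_succ))
      fun j hj => hel j (hj.trans k.lt_succ_self)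
    obtain ⟨j⟩ := (hel k k.lt_succ_self).nonempty_iso hL hP' hQ
    exact ⟨i ≪≫ j⟩

end Independence

end FiniteConley

end

theorem proposition7p4 {R : Type u} [Ring R]
    (L : Endo (GrMod.{u, v} R) ⥤ Auto (GrMod.{u, v} R)) (hL : IsNormal L)
    {X : Type v} [TopologicalSpace X] [Finite X] [T0Space X]
    (F G : X → Set X) (hF : IsAdmissible R F) (hG : IsAdmissible R G)
    (hFG : IsHomotopic R F G) (S_F S_G : Set X)
    (hS_F : IsIsolatedInvariant F S_F) (hS_G : IsIsolatedInvariant G S_G)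
    (hS : RelatedByContinuation R F G S_F S_G) :
    ConleyIndexDefined R F S_F ∧ ConleyIndexDefined R G S_G ∧
      ∀ C_F C_G : Auto (GrMod.{u, v} R),
        IsConleyIndex L F S_F C_F → IsConleyIndex L G S_G C_G → Nonempty (C_F ≅ C_G) := by
  refine ⟨hS_F.conleyIndexDefined hF, hS_G.conleyIndexDefined hG, ?_⟩
  rintro C_F C_G ⟨N, P, hP, ⟨i⟩⟩ ⟨M, Q, hQ, ⟨j⟩⟩
  obtain ⟨k⟩ := hS.nonempty_iso hL hP hQ
  exact ⟨i ≪≫ k ≪≫ j.symm⟩
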